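/- Let $\mathrm{Ree}(3)={}^2G_2(3)\cong \mathrm{P\Gamma L}(2,8)\cong \mathrm{PSL}(2,8)\rtimes C_3$ be the smallest Ree group. The smallest Ree unital $\mathcal R(3)$ is the $2$-$(28,4,1)$ design whose points are the $28$ Sylow $3$-subgroups of $\mathrm{Ree}(3)$, on which $\mathrm{Ree}(3)$ acts by conjugation, and whose blocks are the sets of fixed points of the involutions of $\mathrm{Ree}(3)$. An embedding of $\mathcal R(3)$ in a projective plane $\Pi$ maps points injectively to points and blocks injectively to lines, so that a point and a block are incident if and only if their images are. It is called admissible (in $\Pi$) if for every automorphism $\alpha$ of $\mathcal R(3)$ there is a collineation $\beta$ of $\Pi$ such that $\varphi(P^\alpha)=\varphi(P)^\beta$ for all points $P$. Let $F$ be a field and let $\varphi:\mathcal R(3)\to \mathrm{PG}(2,F)$ be an embedding. Then the following hold. (i) $F$ has a subfield isomorphic to $\mathbb F_8$, and the image of $\varphi$ (points and lines) is contained in a subplane $\Pi_0$ of $\mathrm{PG}(2,F)$ of order $8$. (ii) The embedding is unique up to $\mathrm{Aut}(\mathcal R(3))$ and $\mathrm{PGL}(3,F)$: for every embedding $\psi:\mathcal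 R(3)\to \mathrm{PG}(2,F)$ there are an automorphism $\alpha$ of $\mathcal R(3)$ and a $g\in \mathrm{PGL}(3,F)$ such that $\psi=g\circ\varphi\circ\alpha$ on points and on blocks. (iii) The embedding is admissible as an embedding $\mathcal R(3)\to\Pi_0$. If moreover some automorphism of $F$ does not fix the subfield $\mathbb F_8$ pointwise (for example, if $F$ is finite), then $\varphi$ is also admissible as an embedding in $\mathrm{PG}(2,F)$. -/

import Mathlib

open Configuration
open scoped LinearAlgebra.Projectivization MatrixGroups

/-! ### Incidence structures, embeddings, automorphisms

As in `Mathlib.Combinatorics.Configuration`, an incidence structure is given by a type `P` of points,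
a type `L` of lines (blocks) and a membership relation. -/

/-- An embedding of incidence structures: points go injectively to points, lines go injectively to
lines, and incidence is preserved in both directions. -/
@[ext]
structure IncidenceEmbedding (P L P' L' : Type*) [Membership P L] [Membership P' L'] where
  point : P → P'
  line : L → L'
  point_injective : Function.Injective point
  line_injective : Function.Injective line
  mem_iff : ∀ (p : P) (l : L), point p ∈ line l ↔ p ∈ l

/-- An automorphism of an incidence structure: a permutation of the points together with a
permutation of the lines, preserving incidence in both directions. For a projective plane this is
a collineation. -/
@[ext]
structure IncidenceAut (P L : Type*) [Membership P L] where
  point : P ≃ P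
  line : L ≃ L
  mem_iff : ∀ (p : P) (l : L), point p ∈ line l ↔ p ∈ l

/-- An embedding is admissible if every automorphism of the embedded structure is induced by an
automorphism (collineation) of the ambient structure. -/
def IncidenceEmbedding.IsAdmissible {P L P' L' : Type*} [Membership P L] [Membership P' L']
    (φ : IncidenceEmbedding P L P' L') : Prop :=
  ∀ α : IncidenceAut P L, ∃ β : IncidenceAut P' L',
    ∀ p : P, φ.point (α.point p) = β.point (φ.point p)

/-! ### Subplanes -/

/-- The induced incidence between a set of points and a set of lines. -/
@[reducible]
def inducedMembership {P L : Type*} [Membership P L] (A : Set P) (B : Set L) :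
    Membership A B :=
  ⟨fun l p => (p : P) ∈ (l : L)⟩

/-- A subplane: a set of points and a set of lines which form a projective plane under the induced
incidence. -/
structure Subplane (P L : Type*) [Membership P L] where
  points : Set P
  lines : Set L
  plane : @ProjectivePlane points lines (inducedMembership points lines)

/-- The points and lines of a subplane carry the induced incidence. -/
instance Subplane.membership {P L : Type*} [Membership P L] (S : Subplane P L) :
    Membership S.points S.lines :=
  inducedMembership S.points S.lines

/-- The order of a subplane. -/
noncomputable def Subplane.order {P L : Type*} [Membership P L] (S : Subplane P L) : ℕ :=
  letI := S.plane
  ProjectivePlane.order S.points S.lines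

/-- The image of an embedding is contained in a subplane. -/
structure IncidenceEmbedding.ImageIn {P L P' L' : Type*} [Membership P L] [Membership P' L']
    (φ : IncidenceEmbedding P L P' L') (S : Subplane P' L') : Prop where
  point_mem : ∀ p, φ.point p ∈ S.points
  line_mem : ∀ l, φ.line l ∈ S.lines

/-- An embedding whose image is contained in a subplane, viewed as an embedding in the subplane. -/
def IncidenceEmbedding.codRestrict {P L P' L' : Type*} [Membership P L] [Membership P' L']
    (φ : IncidenceEmbedding P L P' L') (S : Subplane P' L') (h : φ.ImageIn S) :
    IncidenceEmbedding P L S.points S.lines where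
  point p := ⟨φ.point p, h.point_mem p⟩
  line l := ⟨φ.line l, h.line_mem l⟩
  point_injective _ _ e := φ.point_injective (congrArg Subtype.val e)
  line_injective _ _ e := φ.line_injective (congrArg Subtype.val e)
  mem_iff p l := φ.mem_iff p l

/-! ### The classical plane `PG(2,F)`

Points are the one-dimensional subspaces of `F³`. A line is given by its homogeneous coordinates,
again an element of `ℙ F (Fin 3 → F)`; the point `x` lies on the line `u` iff `x ⬝ᵥ u = 0`
(this is Mathlib's incidence `Configuration.ofField`). -/

/-- The points of `PG(2,F)`. -/
abbrev PGPoint (F : Type*) [Field F] : Type _ := ℙ F (Fin 3 → F)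

/-- The lines of `PG(2,F)`, in homogeneous coordinates. -/
abbrev PGLine (F : Type*) [Field F] : Type _ := ℙ F (Fin 3 → F)

/-! ### The group `PΓL(V)` -/

/-- `PΓL(V)`: the group of all permutations of the projective space of `V` that are induced by
bijective semilinear maps `f : V → V`. -/
def PGammaL (K V : Type*) [Field K] [AddCommGroup V] [Module K V] :
    Subgroup (Equiv.Perm (ℙ K V)) where
  carrier := {g | ∃ (σ : K ≃+* K) (f : V ≃+ V), (∀ (c : K) (v : V), f (c • v) = σ c • f v) ∧
    ∀ (v : V) (hv : v ≠ 0),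
      g (Projectivization.mk K v hv) =
        Projectivization.mk K (f v) (f.map_ne_zero_iff.mpr hv)}
  one_mem' := ⟨RingEquiv.refl K, AddEquiv.refl V, fun _ _ => rfl, fun _ _ => rfl⟩
  mul_mem' := by
    rintro a b ⟨σ, f, hf, ha⟩ ⟨τ, g, hg, hb⟩
    refine ⟨τ.trans σ, g.trans f, fun c v => ?_, fun v hv => ?_⟩
    · simp [hf, hg]
    · rw [Equiv.Perm.mul_apply, hb, ha]
      rfl
  inv_mem' := by
    rintro a ⟨σ, f, hf, ha⟩
    refine ⟨σ.symm, f.symm, fun c v => ?_, fun v hv => ?_⟩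
    · apply f.injective
      simp [hf]
    · rw [Equiv.Perm.inv_eq_iff_eq, ha]
      simp

/-! ### The smallest Ree group and the smallest Ree unital -/

/-- The smallest Ree group `Ree(3) = ²G₂(3)`, in its model `PΓL(2,8)`. -/
abbrev Ree3 : Type :=
  PGammaL (GaloisField 2 3) (Fin 2 → GaloisField 2 3)

/-- The points of the Ree unital `R(3)` are the Sylow `3`-subgroups of `Ree(3)`, on which `Ree(3)`
acts by conjugation. -/
abbrev ReeUnitalPoint : Type := Sylow 3 Ree3

/-- The blocks of the Ree unital `R(3)` are the sets of fixed points of the involutions of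
`Ree(3)`. -/
def ReeUnitalBlock : Type :=
  {B : Set ReeUnitalPoint // ∃ t : Ree3, orderOf t = 2 ∧ B = MulAction.fixedBy ReeUnitalPoint t}

/-- Incidence in `R(3)` is membership. -/
instance reeUnitalMembership : Membership ReeUnitalPoint ReeUnitalBlock :=
  ⟨fun B P => P ∈ B.1⟩

/-- Embeddings of the Ree unital `R(3)` in `PG(2,F)`. -/
abbrev ReeUnitalEmbedding (F : Type*) [Field F] : Type _ :=
  IncidenceEmbedding ReeUnitalPoint ReeUnitalBlock (PGPoint F) (PGLine F)

/-- The collineation `β` of `PG(2,F)` is induced by an element of `PGL(3,F)`. -/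
def IsProjectiveLinear {F : Type*} [Field F] (β : IncidenceAut (PGPoint F) (PGLine F)) : Prop :=
  ∃ g : PGL(Fin 3, F), ∀ x : PGPoint F, β.point x = g • x

/-! The matrices of order three in SL(2,8) are those of trace and determinant one, and the inverse m
+ 1 of such an m has the same off-diagonal entries b, c. So the subgroup {1, m, m + 1} is a pair (b,
c), where bc must have absolute trace one; there are 28 such pairs. A matrix with rows (p, q), (r,
p) that induces an involution normalizes this subgroup iff it inverts m, that is, iff the trace p +
qc + rb of the product vanishes. In the coordinates (1, c, b) this is the equation of a line of
PG(2,8). Hence the unital consists of the points that avoid a dual hyperoval (the lines (p, q, r)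
with p² = qr, together with (1, 0, 0)), and its blocks are the other 63 lines
(`ofGL_smul_eq_self_iff`, `exists_isCoordinatization`). The Sylow 3-subgroups are matched with these
points by counting in a doubly transitive group (`DoublyTransitiveAt.exists_equiv_sylow`).

An embedding enters only through its collinear triples. With four points moved to the standard frame
and a fifth one at (1, t, 0), joins and meets determine the others. The incidences then force t³ -
3t + 1 = 0 and 2 = 0, so t generates a field with eight elements, and the embedding is the standard
one followed by a homomorphism ι from `K8` to F and an invertible matrix
(`Realizes.exists_hom_matrix`).

Everything follows from this rigidity. The image of PG(2,8) is the subplane. For F = `K8` the result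
says that automorphisms of the unital are semilinear, whence admissibility in the subplane. Two
choices of ι differ by a power of Frobenius, which itself acts on the unital, whence uniqueness.
Finally, an automorphism of F that is nontrivial on the subfield induces a generator of its Galois
group of order three, so its powers extend every semilinear map needed. -/

/-! ### A decidable model of the field with eight elements -/

/-- The field with eight elements, in the model `𝔽₂[w]/(w³ + w + 1)`: the number
`a₀ + 2 a₁ + 4 a₂` with binary digits `aᵢ` stands for `a₀ + a₁ w + a₂ w²`. -/
def K8 : Type := Fin 8

namespace K8

instance : DecidableEq K8 := inferInstanceAs (DecidableEq (Fin 8))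

instance : Fintype K8 := inferInstanceAs (Fintype (Fin 8))

/-- The element with the given binary digits. -/
def ofNat (n : ℕ) : K8 := ⟨n % 8, Nat.mod_lt _ (by decide)⟩

/-- The generator. -/
def w : K8 := ofNat 2

instance : Zero K8 := ⟨ofNat 0⟩

instance : One K8 := ⟨ofNat 1⟩

instance : Add K8 := ⟨fun a b => ofNat (Nat.xor a.val b.val)⟩

instance : Neg K8 := ⟨fun a => a⟩

/-- Multiplication by `w`: a shift, followed by the reduction `w³ = w + 1`. -/
def mulW (n : ℕ) : ℕ := Nat.xor (2 * n) (11 * (n / 4))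

instance : Mul K8 := ⟨fun a b => ofNat <| Nat.xor (a.val % 2 * b.val) <|
  Nat.xor (a.val / 2 % 2 * mulW b.val) (a.val / 4 * mulW (mulW b.val))⟩

/-- The inverse is the sixth power. -/
instance : Inv K8 := ⟨fun a => a * a * (a * a) * (a * a)⟩

instance : Field K8 where
  add_assoc := by decide +kernel
  zero_add := by decide +kernel
  add_zero := by decide +kernel
  nsmul := nsmulRec
  zsmul := zsmulRec
  add_comm := by decide +kernel
  left_distrib := by decide +kernel
  right_distrib := by decide +kernel
  zero_mul := by decide +kernel
  mul_zero := by decide +kernel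
  mul_assoc := by decide +kernel
  one_mul := by decide +kernel
  mul_one := by decide +kernel
  neg_add_cancel := by decide +kernel
  mul_comm := by decide +kernel
  exists_pair_ne := ⟨0, 1, by decide⟩
  mul_inv_cancel := by decide +kernel
  inv_zero := by decide +kernel
  nnqsmul := _
  nnqsmul_def := fun _ _ => rfl
  qsmul := _
  qsmul_def := fun _ _ => rfl

theorem card_eq : Fintype.card K8 = 8 := by decide

instance : CharP K8 2 := CharTwo.of_one_ne_zero_of_two_eq_zero (by decide) (by decide)

theorem neg_eq (a : K8) : -a = a := rfl

theorem w_pow_three : w ^ 3 = w + 1 := by decide +kernel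

theorem pow_eight (a : K8) : a ^ 8 = a := by revert a; decide +kernel

/-- The coordinates of an element with respect to the basis `1, w, w²`. -/
def digit (a : K8) (i : ℕ) : ℕ := a.val / 2 ^ i % 2

theorem eq_digits (a : K8) :
    a = (a.digit 0 : K8) + (a.digit 1 : K8) * w + (a.digit 2 : K8) * w ^ 2 := by
  revert a; decide +kernel

/-- Two ring homomorphisms out of `K8` which agree on the generator are equal. -/
theorem ringHom_ext {R : Type*} [Semiring R] {f g : K8 →+* R} (h : f w = g w) : f = g := by
  ext a
  rw [eq_digits a]
  simp [h]

/-- The Frobenius automorphism. -/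
def frob : K8 ≃+* K8 where
  toFun a := a * a
  invFun a := a * a * (a * a)
  left_inv := by decide +kernel
  right_inv := by decide +kernel
  map_mul' := by decide +kernel
  map_add' := by decide +kernel

theorem frob_apply (a : K8) : frob a = a * a := rfl

/-- The absolute trace. -/
def trace (a : K8) : K8 := a + a * a + a * a * (a * a)

/-- The ring homomorphism from `K8` determined by a root of `X³ + X + 1` in characteristic two. -/
def lift {R : Type*} [CommRing R] [CharP R 2] (r : R) (hr : r ^ 3 = r + 1) : K8 →+* R where
  toFun a := a.digit 0 + a.digit 1 * r + a.digit 2 * r ^ 2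
  map_one' := by
    have h : (1 : K8).digit 0 = 1 ∧ (1 : K8).digit 1 = 0 ∧ (1 : K8).digit 2 = 0 := by decide
    simp [h]
  map_zero' := by
    have h : (0 : K8).digit 0 = 0 ∧ (0 : K8).digit 1 = 0 ∧ (0 : K8).digit 2 = 0 := by decide
    simp [h]
  map_add' := by
    have h : ∀ a b : K8, ∀ i : Fin 3, ((a + b).digit i) ≡ (a.digit i + b.digit i) [MOD 2] := by
      decide +kernel
    have h' (a b : K8) (i : Fin 3) : ((a + b).digit i : R) = a.digit i + b.digit i := by
      rw [← Nat.cast_add]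
      exact (CharP.natCast_eq_natCast' R 2) (h a b i)
    intro a b
    have h0 := h' a b 0
    have h1 := h' a b 1
    have h2 := h' a b 2
    simp only [Fin.val_zero, Fin.val_one, Fin.val_two] at h0 h1 h2
    rw [h0, h1, h2]
    ring
  map_mul' := by
    have h : ∀ a b : K8,
        ((a * b).digit 0) ≡ (a.digit 0 * b.digit 0 + a.digit 1 * b.digit 2
          + a.digit 2 * b.digit 1) [MOD 2] ∧
        ((a * b).digit 1) ≡ (a.digit 0 * b.digit 1 + a.digit 1 * b.digit 0
          + a.digit 1 * b.digit 2 + a.digit 2 * b.digit 1 + a.digit 2 * b.digit 2) [MOD 2] ∧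
        ((a * b).digit 2) ≡ (a.digit 0 * b.digit 2 + a.digit 1 * b.digit 1
          + a.digit 2 * b.digit 0 + a.digit 2 * b.digit 2) [MOD 2] := by
      decide +kernel
    intro a b
    obtain ⟨h0, h1, h2⟩ := h a b
    have h0 := CharP.natCast_eq_natCast' R 2 h0
    have h1 := CharP.natCast_eq_natCast' R 2 h1
    have h2 := CharP.natCast_eq_natCast' R 2 h2
    push_cast at h0 h1 h2
    rw [h0, h1, h2]
    -- The terms of degree three and four of the product are reduced by r³ = r + 1 and r⁴ = r² + r.
    linear_combination (-(a.digit 1 * b.digit 2 + a.digit 2 * b.digit 1 : R)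
      - a.digit 2 * b.digit 2 * r) * hr

theorem lift_w {R : Type*} [CommRing R] [CharP R 2] (r : R) (hr : r ^ 3 = r + 1) :
    lift r hr w = r := by
  have h : w.digit 0 = 0 ∧ w.digit 1 = 1 ∧ w.digit 2 = 0 := by decide
  change (w.digit 0 + w.digit 1 * r + w.digit 2 * r ^ 2 : R) = r
  simp [h]

/-- Any two ring homomorphisms from `K8` to a domain differ by a power of Frobenius. -/
theorem exists_frob_pow {R : Type*} [CommRing R] [IsDomain R] (f g : K8 →+* R) :
    ∃ k : Fin 3, ∀ a, g a = f ((frob ^ (k : ℕ)) a) := by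
  have key : ∃ k : Fin 3, g w = f ((frob ^ (k : ℕ)) w) := by
    have hf := congrArg f w_pow_three
    have hg := congrArg g w_pow_three
    simp only [map_pow, map_add, map_one] at hf hg
    have h2 : (2 : R) = 0 := by
      rw [← map_ofNat f 2, show (OfNat.ofNat 2 : K8) = 0 by decide, map_zero]
    -- In characteristic two the roots of X³ + X + 1 are x, x², x⁴ as soon as x is one of them.
    have h0 : (g w - f w) * ((g w - f w ^ 2) * (g w - f w ^ 4)) = 0 := by
      set x := f w
      set y := g w
      linear_combination hg
        + (-y ^ 2 * x + y * (x ^ 3 + x ^ 2 + x + 3) - x ^ 4 - x ^ 2 - x - 1) * hf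
        + (-y ^ 2 * (x + x ^ 2) + y * (x ^ 2 + 2 * x + 2) - x ^ 2 - x) * h2
    rcases mul_eq_zero.1 h0 with h | h
    · exact ⟨0, by simpa [sub_eq_zero] using h⟩
    rcases mul_eq_zero.1 h with h | h
    · refine ⟨1, ?_⟩
      rw [sub_eq_zero.1 h]
      simp [frob_apply, sq]
    · refine ⟨2, ?_⟩
      rw [sub_eq_zero.1 h]
      change f w ^ 4 = f (w * w * (w * w))
      simp only [map_mul]
      ring
  obtain ⟨k, hk⟩ := key
  refine ⟨k, fun a => ?_⟩
  have : g = f.comp ((frob ^ (k : ℕ) : K8 ≃+* K8) : K8 →+* K8) := ringHom_ext hk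
  rw [this]
  rfl

end K8

/-! ### Triple products and proportional vectors -/

section TripleProduct

variable {R F : Type*} [CommRing R] [Field F]

/-- The determinant of three vectors. -/
def tripleProduct (u v w : Fin 3 → R) : R :=
  u 0 * (v 1 * w 2 - v 2 * w 1) + u 1 * (v 2 * w 0 - v 0 * w 2) + u 2 * (v 0 * w 1 - v 1 * w 0)

theorem tripleProduct_eq_cross_dot (u v w : Fin 3 → R) :
    tripleProduct u v w = crossProduct u v ⬝ᵥ w := by
  simp [tripleProduct, cross_apply, dotProduct, Fin.sum_univ_three]
  ring

theorem tripleProduct_mulVec (A : Matrix (Fin 3) (Fin 3) R) (u v w : Fin 3 → R) :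
    tripleProduct (A.mulVec u) (A.mulVec v) (A.mulVec w) = A.det * tripleProduct u v w := by
  simp [tripleProduct, Matrix.det_fin_three, Matrix.mulVec, dotProduct, Fin.sum_univ_three]
  ring

theorem tripleProduct_smul (r s t : R) (u v w : Fin 3 → R) :
    tripleProduct (r • u) (s • v) (t • w) = r * s * t * tripleProduct u v w := by
  simp [tripleProduct]
  ring

theorem tripleProduct_map {S : Type*} [CommRing S] (f : R →+* S) (u v w : Fin 3 → R) :
    tripleProduct (f ∘ u) (f ∘ v) (f ∘ w) = f (tripleProduct u v w) := by
  simp [tripleProduct]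

/-- Two vectors are proportional if they differ by a nonzero scalar factor. -/
def Proportional (u v : Fin 3 → F) : Prop := ∃ s : F, s ≠ 0 ∧ u = s • v

theorem Proportional.symm {u v : Fin 3 → F} : Proportional u v → Proportional v u := by
  rintro ⟨s, hs, rfl⟩
  exact ⟨s⁻¹, inv_ne_zero hs, by rw [smul_smul, inv_mul_cancel₀ hs, one_smul]⟩

theorem Proportional.trans {u v w : Fin 3 → F} :
    Proportional u v → Proportional v w → Proportional u w := by
  rintro ⟨s, hs, rfl⟩ ⟨t, ht, rfl⟩
  exact ⟨s * t, mul_ne_zero hs ht, by rw [smul_smul]⟩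

theorem Proportional.mulVec {u v : Fin 3 → F} (A : Matrix (Fin 3) (Fin 3) F) :
    Proportional u v → Proportional (A.mulVec u) (A.mulVec v) := by
  rintro ⟨s, hs, rfl⟩
  exact ⟨s, hs, Matrix.mulVec_smul A s v⟩

theorem proportional_of_cross_eq_zero {u v : Fin 3 → F} (hu : u ≠ 0) (hv : v ≠ 0)
    (h : crossProduct u v = 0) : Proportional u v := by
  rw [← Projectivization.mk_eq_mk_iff_crossProduct_eq_zero hu hv,
    Projectivization.mk_eq_mk_iff] at h
  obtain ⟨s, hs⟩ := h
  exact ⟨s, s.ne_zero, hs.symm⟩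

/-- The intersection point of two distinct lines is unique. -/
theorem proportional_of_meet {a b c d x y : Fin 3 → F} (hx : x ≠ 0) (hy : y ≠ 0)
    (hax : tripleProduct a b x = 0) (hcx : tripleProduct c d x = 0)
    (hay : tripleProduct a b y = 0) (hcy : tripleProduct c d y = 0)
    (habc : tripleProduct a b c ≠ 0) (hacd : tripleProduct a c d ≠ 0) :
    Proportional x y := by
  -- The two lines meet in (a × b) × (c × d). Its cross product with a is a multiple of b × a by the
  -- determinant of a, c, d, so it is nonzero when c is off the first line and a is off the second.
  have hn : crossProduct (crossProduct a b) (crossProduct c d) ≠ 0 := by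
    intro h
    have h1 : crossProduct (crossProduct (crossProduct a b) (crossProduct c d)) a =
        (tripleProduct a c d) • crossProduct b a := by
      ext i
      fin_cases i <;> simp [tripleProduct, cross_apply] <;> ring
    rw [h, LinearMap.map_zero, LinearMap.zero_apply] at h1
    have h2 : crossProduct b a = 0 := (smul_eq_zero.1 h1.symm).resolve_left hacd
    apply habc
    rw [tripleProduct_eq_cross_dot, ← cross_anticomm, h2]
    simp
  have key : ∀ z : Fin 3 → F, z ≠ 0 → tripleProduct a b z = 0 → tripleProduct c d z = 0 →
      Proportional z (crossProduct (crossProduct a b) (crossProduct c d)) := by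
    intro z hz h1 h2
    refine proportional_of_cross_eq_zero hz hn ?_
    have : crossProduct z (crossProduct (crossProduct a b) (crossProduct c d)) =
        (tripleProduct c d z) • crossProduct a b - (tripleProduct a b z) • crossProduct c d := by
      ext i
      fin_cases i <;> simp [tripleProduct, cross_apply] <;> ring
    rw [this, h1, h2]
    simp
  exact (key x hx hax hcx).trans (key y hy hay hcy).symm

/-- Four vectors in general position can be moved to the standard frame. -/
theorem exists_standard_frame {a b c d : Fin 3 → F} (h1 : tripleProduct a b c ≠ 0)
    (h2 : tripleProduct a b d ≠ 0) (h3 : tripleProduct a c d ≠ 0)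
    (h4 : tripleProduct b c d ≠ 0) :
    ∃ A : Matrix (Fin 3) (Fin 3) F, A.det ≠ 0 ∧ Proportional (A.mulVec a) ![1, 0, 0] ∧
      Proportional (A.mulVec b) ![0, 1, 0] ∧ Proportional (A.mulVec c) ![0, 0, 1] ∧
      A.mulVec d = ![1, 1, 1] := by
  -- Each row vanishes on two of a, b, c and is scaled to take the value 1 on d.
  let A : Matrix (Fin 3) (Fin 3) F :=
    ![(tripleProduct b c d)⁻¹ • crossProduct b c, (tripleProduct a c d)⁻¹ • crossProduct a c,
      (tripleProduct a b d)⁻¹ • crossProduct a b]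
  have hA (v : Fin 3 → F) : A.mulVec v = ![(tripleProduct b c d)⁻¹ * tripleProduct b c v,
      (tripleProduct a c d)⁻¹ * tripleProduct a c v,
      (tripleProduct a b d)⁻¹ * tripleProduct a b v] := by
    ext i
    fin_cases i <;> simp only [A, Matrix.mulVec, tripleProduct_eq_cross_dot] <;>
      exact smul_dotProduct _ _ _
  have e1 : tripleProduct b c a = tripleProduct a b c := by simp [tripleProduct]; ring
  have e2 : tripleProduct a c b = -tripleProduct a b c := by simp [tripleProduct]; ring
  have z1 (u v : Fin 3 → F) : tripleProduct u v u = 0 := by simp [tripleProduct]; ring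
  have z2 (u v : Fin 3 → F) : tripleProduct u v v = 0 := by simp [tripleProduct]; ring
  have ha : A.mulVec a = ((tripleProduct b c d)⁻¹ * tripleProduct a b c) • ![1, 0, 0] := by
    rw [hA, z1, z1, e1]; simp
  have hb : A.mulVec b = (-((tripleProduct a c d)⁻¹ * tripleProduct a b c)) • ![0, 1, 0] := by
    rw [hA, z1, z2, e2]; simp
  have hc : A.mulVec c = ((tripleProduct a b d)⁻¹ * tripleProduct a b c) • ![0, 0, 1] := by
    rw [hA, z2, z2]; simp
  refine ⟨A, ?_, ⟨_, ?_, ha⟩, ⟨_, ?_, hb⟩, ⟨_, ?_, hc⟩, ?_⟩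
  · intro h
    have := tripleProduct_mulVec A a b c
    have hI : tripleProduct (![1, 0, 0] : Fin 3 → F) ![0, 1, 0] ![0, 0, 1] = 1 := by
      simp [tripleProduct]
    rw [h, zero_mul, ha, hb, hc, tripleProduct_smul, hI] at this
    simp [h1, h2, h3, h4] at this
  · simp [h1, h4]
  · simp [h1, h3]
  · simp [h1, h2]
  · rw [hA, inv_mul_cancel₀ h2, inv_mul_cancel₀ h3, inv_mul_cancel₀ h4]

end TripleProduct

/-! ### The model of the unital -/

/-- The points of the model of the unital: the affine points `(b, c)` of `PG(2,8)` such that `bc`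
has absolute trace one. -/
abbrev UnitalPoint : Type := {x : K8 × K8 // K8.trace (x.1 * x.2) = 1}

namespace UnitalPoint

/-- The point with the given coordinates. -/
def pt (b c : ℕ) (h : K8.trace (K8.ofNat b * K8.ofNat c) = 1 := by decide) : UnitalPoint :=
  ⟨(K8.ofNat b, K8.ofNat c), h⟩

/-- Homogeneous coordinates of the point `(b, c)`. -/
def coord (x : UnitalPoint) : Fin 3 → K8 := ![1, x.1.2, x.1.1]

theorem coord_ne_zero (x : UnitalPoint) : x.coord ≠ 0 :=
  fun h => one_ne_zero (congrFun h 0)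

theorem exists_noncollinear : ∀ x y : UnitalPoint, x ≠ y →
    ∃ z : UnitalPoint, tripleProduct x.coord y.coord z.coord ≠ 0 := by
  decide +kernel

/-! ### Realizations of the collinear triples over a field -/

/-- The family `v` of vectors realizes the unital: it has the same collinear triples. -/
def Realizes {F : Type*} [Field F] (v : UnitalPoint → Fin 3 → F) : Prop :=
  ∀ x y z : UnitalPoint,
    tripleProduct (v x) (v y) (v z) = 0 ↔ tripleProduct x.coord y.coord z.coord = 0

variable {F : Type*} [Field F] {v : UnitalPoint → Fin 3 → F}

theorem Realizes.mulVec (hv : Realizes v) {A : Matrix (Fin 3) (Fin 3) F} (hA : A.det ≠ 0) :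
    Realizes fun x => A.mulVec (v x) := by
  intro x y z
  rw [tripleProduct_mulVec, ← hv x y z, mul_eq_zero]
  simp [hA]

theorem Realizes.ne_zero (hv : Realizes v) (x : UnitalPoint) : v x ≠ 0 := by
  intro h
  have hne : ∀ x : UnitalPoint, ∃ y, x ≠ y := by decide +kernel
  obtain ⟨y, hy⟩ := hne x
  obtain ⟨z, hz⟩ := exists_noncollinear x y hy
  exact hz ((hv x y z).1 (by simp [h, tripleProduct]))

/-- The point `x` is the intersection of the line through `a` and `b` and the line through `c` and
`d`. -/
def IsMeet (x a b c d : UnitalPoint) : Prop :=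
  tripleProduct a.coord b.coord x.coord = 0 ∧ tripleProduct c.coord d.coord x.coord = 0 ∧
    tripleProduct a.coord b.coord c.coord ≠ 0 ∧ tripleProduct a.coord c.coord d.coord ≠ 0

instance (x a b c d : UnitalPoint) : Decidable (IsMeet x a b c d) :=
  inferInstanceAs (Decidable (_ ∧ _))

theorem Realizes.meet (hv : Realizes v) {x a b c d : UnitalPoint} {a' b' c' d' y : Fin 3 → F}
    (ha : Proportional (v a) a') (hb : Proportional (v b) b') (hc : Proportional (v c) c')
    (hd : Proportional (v d) d') (hx : IsMeet x a b c d) (hy : y ≠ 0)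
    (hay : tripleProduct a' b' y = 0) (hcy : tripleProduct c' d' y = 0) :
    Proportional (v x) y := by
  obtain ⟨h1, h2, h3, h4⟩ := hx
  refine proportional_of_meet (hv.ne_zero x) hy ((hv _ _ _).2 h1) ((hv _ _ _).2 h2) ?_ ?_
    (mt (hv _ _ _).1 h3) (mt (hv _ _ _).1 h4)
  · obtain ⟨r, -, h⟩ := ha
    obtain ⟨s, -, h'⟩ := hb
    rw [h, h', ← one_smul F y, tripleProduct_smul, hay, mul_zero]
  · obtain ⟨r, -, h⟩ := hc
    obtain ⟨s, -, h'⟩ := hd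
    rw [h, h', ← one_smul F y, tripleProduct_smul, hcy, mul_zero]

theorem Realizes.tripleProduct_eq_zero (hv : Realizes v) {a b c : UnitalPoint}
    {a' b' c' : Fin 3 → F} (ha : Proportional (v a) a') (hb : Proportional (v b) b')
    (hc : Proportional (v c) c') :
    tripleProduct a' b' c' = 0 ↔ tripleProduct a.coord b.coord c.coord = 0 := by
  obtain ⟨r, hr, h⟩ := ha.symm
  obtain ⟨s, hs, h'⟩ := hb.symm
  obtain ⟨t, ht, h''⟩ := hc.symm
  rw [h, h', h'', tripleProduct_smul, ← hv]
  simp [hr, hs, ht]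

/-- A realization which agrees with the standard one on five suitable points agrees with it
everywhere. -/
theorem Realizes.proportional_of_five (hv : Realizes v) (ι : K8 →+* F)
    (p72 : Proportional (v (pt 7 2)) (ι ∘ (pt 7 2).coord))
    (p25 : Proportional (v (pt 2 5)) (ι ∘ (pt 2 5).coord))
    (p15 : Proportional (v (pt 1 5)) (ι ∘ (pt 1 5).coord))
    (p63 : Proportional (v (pt 6 3)) (ι ∘ (pt 6 3).coord))
    (p11 : Proportional (v (pt 1 1)) (ι ∘ (pt 1 1).coord)) (x : UnitalPoint) :
    Proportional (v x) (ι ∘ x.coord) := by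
  have step : ∀ x a b c d : UnitalPoint, Proportional (v a) (ι ∘ a.coord) →
      Proportional (v b) (ι ∘ b.coord) → Proportional (v c) (ι ∘ c.coord) →
      Proportional (v d) (ι ∘ d.coord) → IsMeet x a b c d → Proportional (v x) (ι ∘ x.coord) := by
    intro x a b c d ha hb hc hd hx
    refine hv.meet ha hb hc hd hx ?_ ?_ ?_
    · intro h
      exact x.coord_ne_zero (funext fun i => (map_eq_zero ι).1 (congrFun h i))
    · rw [tripleProduct_map, hx.1, map_zero]
    · rw [tripleProduct_map, hx.2.1, map_zero]
  -- The five points generate the unital: in this chain each new point is the meet of two lines that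
  -- join points already reached.
  have p31 := step (pt 3 1) _ _ _ _ p25 p63 p15 p72 (by decide +kernel)
  have p56 := step (pt 5 6) _ _ _ _ p15 p31 p11 p63 (by decide +kernel)
  have p17 := step (pt 1 7) _ _ _ _ p11 p15 p25 p56 (by decide +kernel)
  have p34 := step (pt 3 4) _ _ _ _ p17 p72 p15 p63 (by decide +kernel)
  have p36 := step (pt 3 6) _ _ _ _ p31 p34 p63 p72 (by decide +kernel)
  have p42 := step (pt 4 2) _ _ _ _ p11 p36 p15 p34 (by decide +kernel)
  have p43 := step (pt 4 3) _ _ _ _ p25 p34 p17 p31 (by decide +kernel)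
  have p46 := step (pt 4 6) _ _ _ _ p42 p43 p36 p56 (by decide +kernel)
  have p47 := step (pt 4 7) _ _ _ _ p42 p43 p15 p36 (by decide +kernel)
  have p51 := step (pt 5 1) _ _ _ _ p11 p31 p46 p63 (by decide +kernel)
  have p52 := step (pt 5 2) _ _ _ _ p51 p56 p17 p63 (by decide +kernel)
  have p55 := step (pt 5 5) _ _ _ _ p51 p52 p34 p46 (by decide +kernel)
  have p62 := step (pt 6 2) _ _ _ _ p43 p56 p17 p46 (by decide +kernel)
  have p64 := step (pt 6 4) _ _ _ _ p62 p63 p15 p36 (by decide +kernel)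
  have p65 := step (pt 6 5) _ _ _ _ p62 p63 p15 p25 (by decide +kernel)
  have p71 := step (pt 7 1) _ _ _ _ p11 p31 p34 p56 (by decide +kernel)
  have p74 := step (pt 7 4) _ _ _ _ p71 p72 p25 p42 (by decide +kernel)
  have p77 := step (pt 7 7) _ _ _ _ p71 p72 p43 p56 (by decide +kernel)
  have p13 := step (pt 1 3) _ _ _ _ p11 p15 p25 p42 (by decide +kernel)
  have p24 := step (pt 2 4) _ _ _ _ p65 p72 p31 p47 (by decide +kernel)
  have p26 := step (pt 2 6) _ _ _ _ p24 p25 p17 p52 (by decide +kernel)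
  have p27 := step (pt 2 7) _ _ _ _ p24 p25 p34 p46 (by decide +kernel)
  have p33 := step (pt 3 3) _ _ _ _ p31 p34 p24 p65 (by decide +kernel)
  have hall : ∀ x : UnitalPoint, x ∈ [pt 1 1, pt 1 3, pt 1 5, pt 1 7, pt 2 4, pt 2 5, pt 2 6, pt 2 7, pt 3 1, pt 3 3, pt 3 4, pt 3 6, pt 4 2, pt 4 3, pt 4 6, pt 4 7, pt 5 1, pt 5 2, pt 5 5, pt 5 6, pt 6 2, pt 6 3, pt 6 4, pt 6 5, pt 7 1, pt 7 2, pt 7 4, pt 7 7] := by decide +kernel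
  have := hall x
  simp only [List.mem_cons, List.not_mem_nil, or_false] at this
  rcases this with rfl | rfl | rfl | rfl | rfl | rfl | rfl | rfl | rfl | rfl | rfl | rfl | rfl | rfl | rfl | rfl | rfl | rfl | rfl | rfl | rfl | rfl | rfl | rfl | rfl | rfl | rfl | rfl <;> assumption

/-- Every realization of the unital over a field is obtained from the standard one by a
homomorphism from the field with eight elements and an invertible matrix. -/
theorem Realizes.exists_hom_matrix (hv : Realizes v) :
    ∃ (ι : K8 →+* F) (A : Matrix (Fin 3) (Fin 3) F), A.det ≠ 0 ∧
      ∀ x, Proportional (v x) (A.mulVec (ι ∘ x.coord)) := by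
  obtain ⟨B, hB, p72, p25, p15, p63⟩ := exists_standard_frame
    (mt (hv (pt 7 2) (pt 2 5) (pt 1 5)).1 (by decide +kernel))
    (mt (hv (pt 7 2) (pt 2 5) (pt 6 3)).1 (by decide +kernel))
    (mt (hv (pt 7 2) (pt 1 5) (pt 6 3)).1 (by decide +kernel))
    (mt (hv (pt 2 5) (pt 1 5) (pt 6 3)).1 (by decide +kernel))
  set u : UnitalPoint → Fin 3 → F := fun x => B.mulVec (v x) with hu_def
  have hu : Realizes u := hv.mulVec hB
  replace p63 : Proportional (u (pt 6 3)) ![1, 1, 1] := ⟨1, one_ne_zero, by rw [one_smul, ← p63]⟩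
  -- The point (1, 1) lies on the line through the first two frame points, but not on the line
  -- through the second and third. This leaves one parameter.
  obtain ⟨t, p11⟩ : ∃ t, Proportional (u (pt 1 1)) ![1, t, 0] := by
    have h0 : u (pt 1 1) 2 = 0 := by
      have h := (hu.tripleProduct_eq_zero p72 p25 ⟨1, one_ne_zero, (one_smul F _).symm⟩).2
        (show tripleProduct (pt 7 2).coord (pt 2 5).coord (pt 1 1).coord = 0 by decide +kernel)
      simpa [tripleProduct] using h
    have h1 : u (pt 1 1) 0 ≠ 0 := by
      have h := mt (hu.tripleProduct_eq_zero p25 p15 ⟨1, one_ne_zero, (one_smul F _).symm⟩).1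
        (show tripleProduct (pt 2 5).coord (pt 1 5).coord (pt 1 1).coord ≠ 0 by decide +kernel)
      simpa [tripleProduct] using h
    refine ⟨(u (pt 1 1) 0)⁻¹ * u (pt 1 1) 1, _, h1, ?_⟩
    ext i
    fin_cases i
    · simp
    · simp [h1]
    · simpa using h0
  have ht1 : t - 1 ≠ 0 := by
    have h := mt (hu.tripleProduct_eq_zero p11 p15 p63).1 (by decide +kernel)
    intro h'
    apply h
    simp [tripleProduct]
    linear_combination h'
  -- For a vector such as (t - 1, 0, t) neither entry is known to be nonzero, but their difference
  -- is -1.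
  have nz {x y z : F} (h : x - z ≠ 0 ∨ z ≠ 0) : ![x, y, z] ≠ 0 := by
    intro h'
    have h0 : x = 0 := congrFun h' 0
    have h2 : z = 0 := congrFun h' 2
    simp [h0, h2] at h
  -- The following meets have coordinates polynomial in t, without any assumption on the
  -- characteristic. Incidences not used in the construction then become equations for t.
  have p31 : Proportional (u (pt 3 1)) ![1, 0, 1] :=
    hu.meet p63 p25 p15 p72 (by decide +kernel) (nz (by simp)) (by simp [tripleProduct])
      (by simp [tripleProduct])
  have p56 : Proportional (u (pt 5 6)) ![t - 1, 0, t] :=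
    hu.meet p15 p72 p11 p63 (by decide +kernel) (nz (by simp))
      (by simp [tripleProduct]) (by simp [tripleProduct])
  have p17 : Proportional (u (pt 1 7)) ![t - 1, t ^ 2 - t, t] :=
    hu.meet p11 p15 p25 p56 (by decide +kernel) (nz (by simp))
      (by simp [tripleProduct]; ring) (by simp [tripleProduct]; ring)
  have p34 : Proportional (u (pt 3 4)) ![t - 1, t - 1, 1] :=
    hu.meet p17 p72 p15 p63 (by decide +kernel) (nz (by simp))
      (by simp [tripleProduct]; ring) (by simp [tripleProduct])
  have p36 : Proportional (u (pt 3 6)) ![2 * t - 3, t - 1, t - 1] :=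
    hu.meet p31 p34 p63 p72 (by decide +kernel) (nz (Or.inr ht1))
      (by simp [tripleProduct]; ring) (by simp [tripleProduct])
  have p65 : Proportional (u (pt 6 5)) ![0, t ^ 2 - t, 1] :=
    hu.meet p17 p31 p15 p25 (by decide +kernel) (nz (by simp))
      (by simp [tripleProduct]; ring) (by simp [tripleProduct])
  have p64 : Proportional (u (pt 6 4)) ![t - 1, t ^ 2 - 1, t] :=
    hu.meet p63 p65 p25 p56 (by decide +kernel) (nz (by simp))
      (by simp [tripleProduct]; ring) (by simp [tripleProduct]; ring)
  have hcubic : t ^ 3 - 3 * t + 1 = 0 := by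
    have h := (hu.tripleProduct_eq_zero p11 p65 p36).2 (by decide +kernel)
    simp [tripleProduct] at h
    linear_combination h
  have htwo : (2 : F) = 0 := by
    have h := (hu.tripleProduct_eq_zero p15 p64 p36).2 (by decide +kernel)
    simp [tripleProduct] at h
    have h' : (t - 1) * (2 * (t ^ 2 - t - 1)) = 0 := by linear_combination -h
    have h2 := (mul_eq_zero.1 h').resolve_left ht1
    -- A Bézout identity: (t + 1)(t³ - 3t + 1) - (t² + 2t)(t² - t - 1) = 1.
    linear_combination 2 * (t + 1) * hcubic + (1 - (t + 1) ^ 2) * h2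
  have : CharP F 2 := CharTwo.of_one_ne_zero_of_two_eq_zero one_ne_zero htwo
  have hroot : t ^ 3 = t + 1 := by linear_combination hcubic + (t - 1) * htwo
  let ι : K8 →+* F := K8.lift t hroot
  have hι : ι K8.w = t := K8.lift_w t hroot
  -- The columns are multiples of the model coordinates of the three basis points, scaled so that
  -- (1, 1, 1) goes to the point (6, 3). Then (1, w, 0) goes to the point (1, 1), which matches t
  -- with w.
  let C : Matrix (Fin 3) (Fin 3) K8 :=
    ![![K8.ofNat 5, K8.ofNat 5, K8.ofNat 1], ![K8.ofNat 1, K8.ofNat 7, K8.ofNat 5],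
      ![K8.ofNat 6, K8.ofNat 1, K8.ofNat 1]]
  have hC : C.det ≠ 0 := by
    rw [Matrix.det_fin_three]
    decide +kernel
  have hιC : (C.map ι).det ≠ 0 := by
    rw [← RingHom.mapMatrix_apply, ← RingHom.map_det]
    exact (map_ne_zero ι).2 hC
  have hmap : ∀ (x : UnitalPoint) (a b c s : K8), s ≠ 0 →
      C.mulVec ![a, b, c] = s • x.coord → Proportional (u x) ![ι a, ι b, ι c] →
      Proportional ((C.map ι).mulVec (u x)) (ι ∘ x.coord) := by
    intro x a b c s hs h hx
    refine (hx.mulVec _).trans ⟨ι s, (map_ne_zero ι).2 hs, ?_⟩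
    have h1 : ![ι a, ι b, ι c] = ι ∘ ![a, b, c] := by
      ext i; fin_cases i <;> rfl
    have h2 : (C.map ι).mulVec (ι ∘ ![a, b, c]) = ι ∘ C.mulVec ![a, b, c] := by
      ext i
      exact (RingHom.map_mulVec ι C _ i).symm
    rw [h1, h2, h]
    ext i
    simp
  have hfive := (hu.mulVec hιC).proportional_of_five ι
    (hmap _ 1 0 0 (K8.ofNat 5) (by decide) (by decide +kernel) (by simpa using p72))
    (hmap _ 0 1 0 (K8.ofNat 5) (by decide) (by decide +kernel) (by simpa using p25))
    (hmap _ 0 0 1 (K8.ofNat 1) (by decide) (by decide +kernel) (by simpa using p15))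
    (hmap _ 1 1 1 (K8.ofNat 1) (by decide) (by decide +kernel) (by simpa using p63))
    (hmap _ 1 K8.w 0 (K8.ofNat 4) (by decide) (by decide +kernel) (by simpa [hι] using p11))
  have hD : ((C.map ι) * B).det ≠ 0 := by
    rw [Matrix.det_mul]
    exact mul_ne_zero hιC hB
  refine ⟨ι, ((C.map ι) * B)⁻¹, ?_, fun x => ?_⟩
  · rw [Matrix.det_nonsing_inv, Ring.inverse_eq_inv']
    exact inv_ne_zero hD
  · have h := (hfive x).mulVec (((C.map ι) * B)⁻¹)
    rwa [hu_def, Matrix.mulVec_mulVec, Matrix.mulVec_mulVec, mul_assoc,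
      Matrix.nonsing_inv_mul _ (isUnit_iff_ne_zero.2 hD), Matrix.one_mulVec] at h

end UnitalPoint

/-! ### Sylow 3-subgroups of a doubly transitive group of order 1512 and degree 28 -/

section DoublyTransitive

open scoped Pointwise

variable {G X : Type*} [Group G] [MulAction G X]

/-- Every ordered pair of distinct points is the image of a given one. -/
def DoublyTransitiveAt (G : Type*) {X : Type*} [Group G] [MulAction G X] (x₀ y₀ : X) : Prop :=
  x₀ ≠ y₀ ∧ ∀ x y : X, x ≠ y → ∃ g : G, g • x₀ = x ∧ g • y₀ = y

theorem DoublyTransitiveAt.of_ne {x₀ y₀ x₁ y₁ : X} (h : DoublyTransitiveAt G x₀ y₀)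
    (h₁ : x₁ ≠ y₁) : DoublyTransitiveAt G x₁ y₁ := by
  refine ⟨h₁, fun x y hxy => ?_⟩
  obtain ⟨g, hg, hg'⟩ := h.2 x y hxy
  obtain ⟨k, hk, hk'⟩ := h.2 x₁ y₁ h₁
  exact ⟨g * k⁻¹, by rw [← hk, mul_smul, inv_smul_smul, hg],
    by rw [← hk', mul_smul, inv_smul_smul, hg']⟩

/-- The order of a doubly transitive group. -/
theorem DoublyTransitiveAt.card_mul_card_stabilizer [Finite X] {x₀ y₀ : X}
    (h : DoublyTransitiveAt G x₀ y₀) :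
    (Nat.card X * Nat.card X - Nat.card X) * Nat.card (MulAction.stabilizer G (x₀, y₀)) =
      Nat.card G := by
  classical
  have horb : MulAction.orbit G (x₀, y₀) = {p : X × X | p.1 ≠ p.2} := by
    ext ⟨x, y⟩
    constructor
    · rintro ⟨g, hg⟩
      have h1 : g • x₀ = x := congrArg Prod.fst hg
      have h2 : g • y₀ = y := congrArg Prod.snd hg
      change x ≠ y
      rw [← h1, ← h2]
      exact fun e => h.1 (smul_left_cancel g e)
    · intro hxy
      obtain ⟨g, hg, hg'⟩ := h.2 x y hxy
      exact ⟨g, Prod.ext hg hg'⟩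
  have hcard : Nat.card {p : X × X | p.1 ≠ p.2} = Nat.card X * Nat.card X - Nat.card X := by
    have := Fintype.ofFinite X
    have h1 : {p : X × X | p.1 ≠ p.2} = ((Finset.univ : Finset X).offDiag : Set (X × X)) := by
      ext p
      simp
    rw [h1, Nat.card_coe_set_eq, Set.ncard_coe_finset, Finset.offDiag_card, Finset.card_univ,
      Nat.card_eq_fintype_card]
  rw [← hcard, ← horb, Nat.card_congr (MulAction.orbitProdStabilizerEquivGroup G (x₀, y₀)).symm,
    Nat.card_prod]

/-- A doubly transitive group of order `1512` and degree `28` acts on its Sylow `3`-subgroups in the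
same way as on the points. -/
theorem DoublyTransitiveAt.exists_equiv_sylow [Finite G] [Finite X] {x₀ y₀ : X}
    (h : DoublyTransitiveAt G x₀ y₀) (hX : Nat.card X = 28) (hG : Nat.card G = 1512) :
    ∃ e : Sylow 3 G ≃ X, ∀ (g : G) (P : Sylow 3 G), e (g • P) = g • e P := by
  have : Fact (Nat.Prime 3) := ⟨Nat.prime_three⟩
  have hP (P : Sylow 3 G) : Nat.card P = 27 := by
    rw [P.card_eq_multiplicity, hG]
    have : Nat.factorization 1512 3 = 3 := by
      rw [Nat.factorization_def _ Nat.prime_three, show 1512 = 3 ^ 3 * 56 by norm_num,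
        padicValNat.mul (by norm_num) (by norm_num), padicValNat.prime_pow,
        padicValNat.eq_zero_of_not_dvd (by norm_num)]
    rw [this]
    norm_num
  -- 1512 = 2 · (28² - 28).
  have hpair (x y : X) (hxy : x ≠ y) : Nat.card (MulAction.stabilizer G (x, y)) = 2 := by
    have := (h.of_ne hxy).card_mul_card_stabilizer
    rw [hX, hG] at this
    omega
  have htrans (x y : X) : ∃ g : G, g • x = y := by
    have hnt : Nontrivial X := ⟨x₀, y₀, h.1⟩
    obtain ⟨z, hz⟩ := exists_ne x
    obtain ⟨z', hz'⟩ := exists_ne y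
    obtain ⟨g, hg, -⟩ := (h.of_ne hz.symm).2 y z' hz'.symm
    exact ⟨g, hg⟩
  have hstab (x : X) : Nat.card (MulAction.stabilizer G x) = 54 := by
    have horb : MulAction.orbit G x = Set.univ := Set.eq_univ_of_forall fun y => htrans x y
    have := Nat.card_congr (MulAction.orbitProdStabilizerEquivGroup G x)
    rw [Nat.card_prod, horb, Nat.card_univ, hX, hG] at this
    omega
  -- A 3-group acting on 28 ≡ 1 (mod 3) points fixes one. It fixes only one, since 27 exceeds the
  -- order of the stabilizer of a pair.
  have hfix (P : Sylow 3 G) : ∃ x : X, (P : Subgroup G) ≤ MulAction.stabilizer G x := by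
    have h1 := P.isPGroup'.card_modEq_card_fixedPoints X
    rw [hX] at h1
    have h2 : 0 < Nat.card (MulAction.fixedPoints P X) := by
      rcases Nat.eq_zero_or_pos (Nat.card (MulAction.fixedPoints P X)) with h0 | h0
      · rw [h0] at h1
        exact absurd h1 (by decide)
      · exact h0
    obtain ⟨⟨x, hx⟩⟩ := (Nat.card_pos_iff.1 h2).1
    exact ⟨x, fun g hg => hx ⟨g, hg⟩⟩
  have huniq (P : Sylow 3 G) (x y : X) (hx : (P : Subgroup G) ≤ MulAction.stabilizer G x)
      (hy : (P : Subgroup G) ≤ MulAction.stabilizer G y) : x = y := by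
    by_contra hxy
    have hle : (P : Subgroup G) ≤ MulAction.stabilizer G (x, y) :=
      fun g hg => Prod.ext (hx hg) (hy hg)
    have := Subgroup.card_le_of_le hle
    rw [hpair x y hxy] at this
    have h27 : Nat.card (P : Subgroup G) = 27 := hP P
    omega
  have hinj (P Q : Sylow 3 G) (x : X) (hx : (P : Subgroup G) ≤ MulAction.stabilizer G x)
      (hy : (Q : Subgroup G) ≤ MulAction.stabilizer G x) : P = Q := by
    -- A Sylow 3-subgroup has index 54 / 27 = 2 in the stabilizer of its fixed point, so it is
    -- normal there and hence the only one.
    have hidx : (P.subtype hx : Subgroup (MulAction.stabilizer G x)).index = 2 := by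
      have h1 := (P.subtype hx : Subgroup (MulAction.stabilizer G x)).card_mul_index
      have h2 : Nat.card (P.subtype hx : Subgroup (MulAction.stabilizer G x)) = 27 := by
        rw [← hP P]
        exact Nat.card_congr (Subgroup.subgroupOfEquivOfLe hx).toEquiv
      rw [h2, hstab] at h1
      omega
    have := Subgroup.normal_of_index_eq_two hidx
    have := Sylow.unique_of_normal _ this
    exact Sylow.subtype_injective (hP := hx) (hQ := hy) (Subsingleton.elim _ _)
  choose f hf using hfix
  have hequiv (g : G) (P : Sylow 3 G) : f (g • P) = g • f P := by
    refine huniq (g • P) _ _ (hf _) ?_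
    intro k hk
    have : k ∈ MulAut.conj g • (P : Subgroup G) := hk
    rw [Subgroup.mem_pointwise_smul_iff_inv_smul_mem] at this
    have hfP : (g⁻¹ * k * g) • f P = f P := hf P (by simpa using this)
    rw [MulAction.mem_stabilizer_iff, ← mul_smul]
    nth_rewrite 2 [← hfP]
    rw [← mul_smul]
    congr 1
    group
  have hbij : Function.Bijective f := by
    constructor
    · intro P Q hPQ
      exact hinj P Q (f P) (hf P) (hPQ ▸ hf Q)
    · intro x
      obtain ⟨g, hg⟩ := htrans (f default) x
      exact ⟨g • default, by rw [hequiv, hg]⟩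
  exact ⟨Equiv.ofBijective f hbij, hequiv⟩

end DoublyTransitive

/-! ### The group `PΓL(2,8)` in coordinates -/

/-- The group `PΓL(2,8)` over the decidable model of the field with eight elements. -/
abbrev PGammaL28 : Type := PGammaL K8 (Fin 2 → K8)

namespace PGammaL28

open Projectivization

/-- The homomorphism `GL(2,8) → PΓL(2,8)`. -/
def ofGL : GL (Fin 2) K8 →* PGammaL28 :=
  (MulAction.toPermHom (GL (Fin 2) K8) (ℙ K8 (Fin 2 → K8))).codRestrict _ fun g =>
    ⟨RingEquiv.refl K8, DistribMulAction.toAddEquiv _ g, fun c v => smul_comm g c v,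
      fun _ _ => rfl⟩

theorem ofGL_apply_mk (g : GL (Fin 2) K8) (v : Fin 2 → K8) (hv : v ≠ 0) :
    (ofGL g).1 (mk K8 v hv) = mk K8 (g • v) ((smul_ne_zero_iff_ne g).2 hv) := rfl

theorem frob_comp_ne_zero {v : Fin 2 → K8} (hv : v ≠ 0) (k : ℕ) :
    (fun i => (K8.frob ^ k) (v i)) ≠ 0 := fun h =>
  hv (funext fun i => (map_eq_zero_iff _ (RingEquiv.injective (K8.frob ^ k))).1 (congrFun h i))

/-- The Frobenius map on coordinates, as a semilinear map. -/
def frobMap : (Fin 2 → K8) →ₛₗ[(K8.frob : K8 →+* K8)] (Fin 2 → K8) where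
  toFun v i := K8.frob (v i)
  map_add' u v := by ext i; simp
  map_smul' c v := by ext i; simp

theorem frobMap_injective : Function.Injective frobMap := fun _ _ h =>
  funext fun i => K8.frob.injective (congrFun h i)

theorem frob_pow_three : K8.frob ^ 3 = 1 := by
  ext a
  change K8.frob (K8.frob (K8.frob a)) = a
  revert a
  decide +kernel

theorem map_frobMap_three (x : ℙ K8 (Fin 2 → K8)) :
    map frobMap frobMap_injective (map frobMap frobMap_injective
      (map frobMap frobMap_injective x)) = x := by
  induction x with | h v hv => ?_
  have : ∀ a : K8, K8.frob (K8.frob (K8.frob a)) = a := fun a =>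
    congrArg (fun f : K8 ≃+* K8 => f a) frob_pow_three
  simp only [map_mk]
  congr 1
  exact funext fun i => this (v i)

/-- The element of `PΓL(2,8)` induced by the Frobenius automorphism. -/
def frobeniusElt : PGammaL28 :=
  ⟨⟨map frobMap frobMap_injective,
      fun x => map frobMap frobMap_injective (map frobMap frobMap_injective x),
      map_frobMap_three, map_frobMap_three⟩,
    K8.frob, ⟨⟨fun v i => K8.frob (v i), fun v i => K8.frob.symm (v i),
      fun v => by simp, fun v => by simp⟩, fun u v => by ext i; simp⟩,
    fun c v => by ext i; simp, fun _ _ => rfl⟩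

theorem frobeniusElt_pow_apply_mk (k : ℕ) (v : Fin 2 → K8) (hv : v ≠ 0) :
    (frobeniusElt ^ k).1 (mk K8 v hv) =
      mk K8 (fun i => (K8.frob ^ k) (v i)) (frob_comp_ne_zero hv k) := by
  induction k with
  | zero => rfl
  | succ k ih =>
    rw [pow_succ', Subgroup.coe_mul, Equiv.Perm.mul_apply, ih]
    change mk K8 _ _ = _
    congr 1
    ext i
    rw [pow_succ']
    rfl

theorem frobeniusElt_pow_three : frobeniusElt ^ 3 = 1 := by
  refine Subtype.ext (Equiv.ext fun x => ?_)
  induction x with | h v hv => ?_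
  rw [frobeniusElt_pow_apply_mk]
  simp only [frob_pow_three]
  rfl

theorem frobeniusElt_mul_ofGL (M : GL (Fin 2) K8) :
    frobeniusElt * ofGL M =
      ofGL (Matrix.GeneralLinearGroup.map (K8.frob : K8 →+* K8) M) * frobeniusElt := by
  refine Subtype.ext (Equiv.ext fun x => ?_)
  induction x with | h v hv => ?_
  change mk K8 _ _ = mk K8 _ _
  congr 1
  ext i
  exact RingHom.map_mulVec (K8.frob : K8 →+* K8) M.1 v i

/-- The companion field automorphism of a semilinear map is a power of Frobenius. Once this power is
split off, the map is given by the matrix of its values on the standard basis. -/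
theorem exists_ofGL_mul_frobeniusElt_pow (g : PGammaL28) :
    ∃ (M : GL (Fin 2) K8) (k : Fin 3), g = ofGL M * frobeniusElt ^ (k : ℕ) := by
  obtain ⟨g, σ, f, hf, hg⟩ := g
  obtain ⟨k, hk⟩ := K8.exists_frob_pow (RingHom.id K8) (σ : K8 →+* K8)
  have hk' : ∀ a, σ a = (K8.frob ^ (k : ℕ)) a := hk
  let A : Matrix (Fin 2) (Fin 2) K8 := fun i j => f (Pi.single j 1) i
  have hA (v : Fin 2 → K8) : f v = A.mulVec (fun i => (K8.frob ^ (k : ℕ)) (v i)) := by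
    have hv : v = v 0 • Pi.single 0 1 + v 1 • Pi.single 1 1 := by
      ext i; fin_cases i <;> simp
    conv_lhs => rw [hv]
    rw [map_add, hf, hf, hk', hk']
    ext i
    simp [Matrix.mulVec, dotProduct, Fin.sum_univ_two, A, mul_comm]
  have hu : IsUnit A := by
    rw [← Matrix.mulVec_surjective_iff_isUnit]
    intro w
    obtain ⟨v, hv⟩ := f.surjective w
    exact ⟨_, (hA v).symm.trans hv⟩
  obtain ⟨M, hM⟩ := hu
  refine ⟨M, k, Subtype.ext (Equiv.ext fun x => ?_)⟩
  induction x with | h v hv => ?_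
  rw [Subgroup.coe_mul, Equiv.Perm.mul_apply, frobeniusElt_pow_apply_mk, ofGL_apply_mk, hg]
  congr 1
  rw [hA, ← hM]
  rfl

/-- Linear maps can be moved past Frobenius, whose cube is trivial. This makes involutions linear,
because an involution equals its own cube. -/
theorem exists_pow_three_eq_ofGL (g : PGammaL28) : ∃ M, g ^ 3 = ofGL M := by
  obtain ⟨M, k, rfl⟩ := exists_ofGL_mul_frobeniusElt_pow g
  have key (N : GL (Fin 2) K8) (n : ℕ) :
      ∃ N', frobeniusElt ^ n * ofGL N = ofGL N' * frobeniusElt ^ n := by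
    induction n with
    | zero => exact ⟨N, by simp⟩
    | succ n ih =>
      obtain ⟨N', h⟩ := ih
      exact ⟨_, by rw [pow_succ', mul_assoc, h, ← mul_assoc, frobeniusElt_mul_ofGL, mul_assoc]⟩
  obtain ⟨M₁, h₁⟩ := key M k
  obtain ⟨M₂, h₂⟩ := key M₁ k
  set F := frobeniusElt ^ (k : ℕ) with hF
  have hF3 : F * F * F = 1 := by
    rw [hF, ← pow_add, ← pow_add, show (k : ℕ) + k + k = 3 * k by ring, pow_mul,
      frobeniusElt_pow_three, one_pow]
  refine ⟨M * M₁ * M₂, ?_⟩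
  calc (ofGL M * F) ^ 3 = ofGL M * (F * ofGL M) * (F * ofGL M) * F := by
        simp only [pow_succ, pow_zero, one_mul, mul_assoc]
    _ = ofGL M * ofGL M₁ * (F * ofGL M₁) * F * F := by rw [h₁]; group
    _ = ofGL M * ofGL M₁ * ofGL M₂ * (F * F * F) := by rw [h₂]; group
    _ = ofGL (M * M₁ * M₂) := by rw [hF3]; simp

/-- Fixing the points spanned by (1, 0), (0, 1) and (1, 1) already forces a scalar matrix. -/
theorem exists_smul_of_ofGL_eq_one {M : GL (Fin 2) K8} (h : ofGL M = 1) :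
    ∃ s : K8, M.1 = s • (1 : Matrix (Fin 2) (Fin 2) K8) := by
  have hv (v : Fin 2 → K8) (hv : v ≠ 0) : ∃ s : K8, s • v = M.1.mulVec v := by
    have h1 : (ofGL M).1 (mk K8 v hv) = mk K8 v hv := by rw [h]; rfl
    rw [ofGL_apply_mk, mk_eq_mk_iff'] at h1
    exact h1
  obtain ⟨s, hs⟩ := hv ![1, 0] (fun h => one_ne_zero (congrFun h 0))
  obtain ⟨t, ht⟩ := hv ![0, 1] (fun h => one_ne_zero (congrFun h 1))
  obtain ⟨u, hu⟩ := hv ![1, 1] (fun h => one_ne_zero (congrFun h 0))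
  have s0 := congrFun hs 0
  have s1 := congrFun hs 1
  have t0 := congrFun ht 0
  have t1 := congrFun ht 1
  have u0 := congrFun hu 0
  have u1 := congrFun hu 1
  simp [Matrix.mulVec, dotProduct, Fin.sum_univ_two] at s0 s1 t0 t1 u0 u1
  refine ⟨s, ?_⟩
  ext i j
  fin_cases i <;> fin_cases j <;> simp [← s0, ← s1, ← t0, ← t1]
  rw [← s0, ← t0, add_zero] at u0
  rw [← s1, ← t1, zero_add] at u1
  rw [← u0, ← u1]

theorem ofGL_eq_one_of_smul {M : GL (Fin 2) K8} {s : K8}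
    (h : M.1 = s • (1 : Matrix (Fin 2) (Fin 2) K8)) : ofGL M = 1 := by
  refine Subtype.ext (Equiv.ext fun x => ?_)
  induction x with | h v hv => ?_
  rw [ofGL_apply_mk, Subgroup.coe_one, Equiv.Perm.one_apply, mk_eq_mk_iff']
  refine ⟨s, ?_⟩
  change _ = M.1.mulVec v
  rw [h, Matrix.smul_mulVec, Matrix.one_mulVec]

/-- Two preimages differ by a scalar, which the trace determines. Equations between elements of
order three thus lift from the projective group to matrices. -/
theorem eq_of_ofGL_eq {M N : GL (Fin 2) K8} (hM : M.1.trace = 1) (hN : N.1.trace = 1)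
    (h : ofGL M = ofGL N) : M = N := by
  obtain ⟨s, hs⟩ := exists_smul_of_ofGL_eq_one (M := M * N⁻¹) (by rw [map_mul, h, map_inv]; simp)
  have h1 : M.1 = s • N.1 := by
    have : M.1 = (M * N⁻¹).1 * N.1 := by rw [← Units.val_mul, inv_mul_cancel_right]
    rw [this, hs, Matrix.smul_mul, one_mul]
  rw [h1, Matrix.trace_smul, hN, smul_eq_mul, mul_one] at hM
  exact Units.ext (by rw [h1, hM, one_smul])

/-- Of the 3528 matrices at least 7 are in the kernel, so the linear part has order at most 504, and
Frobenius contributes a factor of at most 3. The opposite bound comes from double transitivity. -/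
theorem card_le : Nat.card PGammaL28 ≤ 1512 := by
  have hGL : Nat.card (GL (Fin 2) K8) = 3528 := by
    rw [Matrix.card_GL_field]
    simp [Fin.prod_univ_two, K8.card_eq]
  have hker : 7 ≤ Nat.card ofGL.ker := by
    have h7 : Nat.card K8ˣ = 7 := by
      rw [Nat.card_units, Nat.card_eq_fintype_card, K8.card_eq]
    rw [← h7]
    refine Nat.card_le_card_of_injective (fun s : K8ˣ => (⟨Units.map
      (Matrix.scalar (Fin 2) : K8 →+* Matrix (Fin 2) (Fin 2) K8).toMonoidHom s, ?_⟩ : ofGL.ker)) ?_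
    · refine ofGL_eq_one_of_smul (s := (s : K8)) ?_
      ext i j
      fin_cases i <;> fin_cases j <;> simp
    · intro s t hst
      have h := congrArg (fun M : ofGL.ker => M.1.1 0 0) hst
      exact Units.ext (by simpa using h)
  have hrange : Nat.card ofGL.range ≤ 504 := by
    have h1 := ofGL.ker.card_mul_index
    rw [Subgroup.index_ker, hGL] at h1
    nlinarith
  calc Nat.card PGammaL28 ≤ Nat.card (ofGL.range × Fin 3) := by
        refine Nat.card_le_card_of_surjective
          (fun p : ofGL.range × Fin 3 => p.1.1 * frobeniusElt ^ (p.2 : ℕ)) fun g => ?_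
        obtain ⟨M, k, rfl⟩ := exists_ofGL_mul_frobeniusElt_pow g
        exact ⟨(⟨ofGL M, M, rfl⟩, k), rfl⟩
    _ = Nat.card ofGL.range * 3 := by rw [Nat.card_prod, Nat.card_fin]
    _ ≤ 1512 := by omega

end PGammaL28

/-! ### The action of `PΓL(2,8)` on the model of the unital -/

namespace UnitalPoint

open PGammaL28

/-- A root of `X² + X = 1 + bc`, given by the half-trace. -/
def root (x : UnitalPoint) : K8 :=
  let y := 1 + x.1.1 * x.1.2
  y * y * (y * y) + y

/-- A matrix of order three attached to the point `x`; its square is `x.mat + 1`. -/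
def mat (x : UnitalPoint) : Matrix (Fin 2) (Fin 2) K8 := !![x.root, x.1.1; x.1.2, x.root + 1]

/-- Both 1 and bc have trace one, so 1 + bc has trace zero and the Artin–Schreier equation is
solvable. -/
theorem root_mul (x : UnitalPoint) : x.root * (x.root + 1) = 1 + x.1.1 * x.1.2 := by
  revert x; decide +kernel

/-- This is Cayley–Hamilton for trace and determinant one in characteristic two. -/
theorem mat_mul_mat_add_one (x : UnitalPoint) : x.mat * (x.mat + 1) = 1 := by
  have h := x.root_mul
  have h2 := CharTwo.add_self_eq_zero (x.1.1 * x.1.2)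
  have h3 := CharTwo.add_self_eq_zero (x.root)
  ext i j
  fin_cases i <;> fin_cases j <;> simp [mat, Matrix.mul_apply, Fin.sum_univ_two]
  · linear_combination h + h2
  · linear_combination (x.1.1) * h3 + CharTwo.add_self_eq_zero (x.1.1)
  · linear_combination (x.1.2) * h3 + CharTwo.add_self_eq_zero (x.1.2)
  · linear_combination h + h2 + CharTwo.add_self_eq_zero (x.root + 1)

/-- The matrix `x.mat` as an element of the general linear group. -/
def gl (x : UnitalPoint) : GL (Fin 2) K8 where
  val := x.mat
  inv := x.mat + 1
  val_inv := x.mat_mul_mat_add_one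
  inv_val := by
    rw [add_mul, one_mul, ← mul_add_one, mat_mul_mat_add_one]

theorem gl_inv_val (x : UnitalPoint) : (x.gl⁻¹).1 = x.mat + 1 := rfl

theorem trace_mat (x : UnitalPoint) : x.mat.trace = 1 := by
  rw [mat, Matrix.trace_fin_two_of, ← add_assoc, CharTwo.add_self_eq_zero, zero_add]

theorem trace_mat_add_one (x : UnitalPoint) : (x.mat + 1).trace = 1 := by
  rw [Matrix.trace_add, trace_mat, Matrix.trace_one, Fintype.card_fin]
  decide

/-- Matrices of trace one and determinant one come from points. -/
theorem exists_gl_eq {M : GL (Fin 2) K8} (ht : M.1.trace = 1) (hd : M.1.det = 1) :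
    ∃ x : UnitalPoint, M = x.gl ∨ M = x.gl⁻¹ := by
  -- The two solutions of X² + X = 1 + bc differ by 1; they belong to the matrix of the point and to
  -- its inverse.
  have key : ∀ a b c : K8, a * (a + 1) + b * c = 1 → ∃ h : K8.trace (b * c) = 1,
      a = root ⟨(b, c), h⟩ ∨ a = root ⟨(b, c), h⟩ + 1 := by decide +kernel
  have hd' : M.1 1 1 = M.1 0 0 + 1 := by
    rw [Matrix.trace_fin_two] at ht
    linear_combination ht - CharTwo.add_self_eq_zero (M.1 0 0)
  rw [Matrix.det_fin_two, hd', sub_eq_add_neg, K8.neg_eq] at hd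
  obtain ⟨h, h'⟩ := key _ _ _ hd
  refine ⟨⟨(M.1 0 1, M.1 1 0), h⟩, h'.imp (fun h' => ?_) (fun h' => ?_)⟩
  · ext i j
    fin_cases i <;> fin_cases j
    · exact h'
    · rfl
    · rfl
    · exact hd'.trans (congrArg (· + 1) h')
  · ext i j
    rw [gl_inv_val]
    fin_cases i <;> fin_cases j
    · exact h'
    · simp [mat]
    · simp [mat]
    · exact hd'.trans (congrArg (· + 1) h')

/-- The element of order three of `PΓL(2,8)` attached to the point `x`. -/
def elt (x : UnitalPoint) : PGammaL28 := ofGL x.gl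

/-- The element `g` conjugates the subgroup of order three attached to `x` to the one attached
to `y`. -/
def Conj (g : PGammaL28) (x y : UnitalPoint) : Prop :=
  g * x.elt = y.elt * g ∨ g * x.elt = y.elt⁻¹ * g

theorem Conj.mul {g h : PGammaL28} {x y z : UnitalPoint} (hxy : Conj g x y) (hyz : Conj h y z) :
    Conj (h * g) x z := by
  have e1 : x.elt = g⁻¹ * y.elt * g ∨ x.elt = g⁻¹ * y.elt⁻¹ * g := hxy.imp
    (fun e => by rw [mul_assoc, ← e, inv_mul_cancel_left])
    (fun e => by rw [mul_assoc, ← e, inv_mul_cancel_left])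
  have e2 : y.elt = h⁻¹ * z.elt * h ∨ y.elt = h⁻¹ * z.elt⁻¹ * h := hyz.imp
    (fun e => by rw [mul_assoc, ← e, inv_mul_cancel_left])
    (fun e => by rw [mul_assoc, ← e, inv_mul_cancel_left])
  rcases e1 with e1 | e1 <;> rcases e2 with e2 | e2
  · left; rw [e1, e2]; group
  · right; rw [e1, e2]; group
  · right; rw [e1, e2]; group
  · left; rw [e1, e2]; group

theorem conj_one (x : UnitalPoint) : Conj 1 x x := Or.inl (by simp)

/-- A trace-one matrix and its sum with 1 have the same off-diagonal entries, and these are the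
coordinates of the point. -/
theorem Conj.unique {g : PGammaL28} {x y z : UnitalPoint} (hy : Conj g x y) (hz : Conj g x z) :
    y = z := by
  have key : y.elt = z.elt ∨ y.elt = z.elt⁻¹ := by
    rcases hy with hy | hy <;> rcases hz with hz | hz <;> rw [hy] at hz
    · exact Or.inl (mul_right_cancel hz)
    · exact Or.inr (mul_right_cancel hz)
    · exact Or.inr (inv_eq_iff_eq_inv.1 (mul_right_cancel hz))
    · exact Or.inl (inv_injective (mul_right_cancel hz))
  have h01 : y.mat 0 1 = z.mat 0 1 ∧ y.mat 1 0 = z.mat 1 0 := by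
    rcases key with h | h
    · have := congrArg Units.val (eq_of_ofGL_eq y.trace_mat z.trace_mat h)
      exact ⟨congrFun (congrFun this 0) 1, congrFun (congrFun this 1) 0⟩
    · rw [elt, elt, ← map_inv] at h
      have := congrArg Units.val (eq_of_ofGL_eq y.trace_mat z.trace_mat_add_one h)
      rw [gl_inv_val] at this
      have h1 := congrFun (congrFun this 0) 1
      have h2 := congrFun (congrFun this 1) 0
      simp only [Matrix.add_apply, Matrix.one_apply, Fin.zero_eq_one_iff, Fin.one_eq_zero_iff,
        OfNat.ofNat_ne_one, if_false, add_zero] at h1 h2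
      exact ⟨h1, h2⟩
  exact Subtype.ext (Prod.ext h01.1 h01.2)

/-- Conjugation preserves trace and determinant, which characterize the matrices attached to points.
-/
theorem exists_conj_ofGL (M : GL (Fin 2) K8) (x : UnitalPoint) : ∃ y, Conj (ofGL M) x y := by
  obtain ⟨y, hy⟩ := exists_gl_eq (M := M * x.gl * M⁻¹)
    (by
      rw [Units.val_mul, Units.val_mul, Matrix.trace_units_conj]
      exact x.trace_mat)
    (by
      have hx : x.mat.det = 1 := by
        rw [mat, Matrix.det_fin_two_of, x.root_mul, add_sub_cancel_right]
      rw [Units.val_mul, Units.val_mul, Matrix.det_units_conj]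
      exact hx)
  refine ⟨y, hy.imp (fun h => ?_) (fun h => ?_)⟩
  · rw [elt, elt, ← h]; simp
  · rw [elt, elt, ← map_inv, ← h]; simp

/-- The Frobenius automorphism acts on the points of the unital. -/
def frob (x : UnitalPoint) : UnitalPoint :=
  ⟨(K8.frob x.1.1, K8.frob x.1.2), by revert x; decide +kernel⟩

theorem conj_frobeniusElt (x : UnitalPoint) : Conj frobeniusElt x x.frob := by
  left
  rw [elt, frobeniusElt_mul_ofGL]
  congr 2
  have h : ∀ x : UnitalPoint, K8.frob x.root = x.frob.root := by decide +kernel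
  ext i j
  fin_cases i <;> fin_cases j
  · exact h x
  · rfl
  · rfl
  · exact (map_add K8.frob _ _).trans (by rw [h]; rfl)

theorem conj_frobeniusElt_pow (k : ℕ) (x : UnitalPoint) :
    Conj (frobeniusElt ^ k) x (frob^[k] x) := by
  induction k with
  | zero => exact conj_one x
  | succ k ih =>
    rw [pow_succ', Function.iterate_succ_apply']
    exact ih.mul (conj_frobeniusElt _)

theorem exists_conj (g : PGammaL28) (x : UnitalPoint) : ∃ y, Conj g x y := by
  obtain ⟨M, k, rfl⟩ := exists_ofGL_mul_frobeniusElt_pow g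
  obtain ⟨y, hy⟩ := exists_conj_ofGL M (frob^[k] x)
  exact ⟨y, (conj_frobeniusElt_pow k x).mul hy⟩

/-- The action of `PΓL(2,8)` on the unital, which corresponds to the conjugation of subgroups of
order three. -/
noncomputable instance : MulAction PGammaL28 UnitalPoint where
  smul g x := (exists_conj g x).choose
  one_smul x := (exists_conj 1 x).choose_spec.unique (conj_one x)
  mul_smul g h x := (exists_conj (g * h) x).choose_spec.unique
    ((exists_conj h x).choose_spec.mul (exists_conj g _).choose_spec)

theorem smul_eq_iff {g : PGammaL28} {x y : UnitalPoint} : g • x = y ↔ Conj g x y :=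
  ⟨fun h => h ▸ (exists_conj g x).choose_spec, fun h => (exists_conj g x).choose_spec.unique h⟩

/-- All matrices involved have trace one, so no scalar factor appears when the relation is lifted.
-/
theorem conj_ofGL_iff (M : GL (Fin 2) K8) (x y : UnitalPoint) :
    Conj (ofGL M) x y ↔ M.1 * x.mat = y.mat * M.1 ∨ M.1 * x.mat = (y.mat + 1) * M.1 := by
  have key (N N' : GL (Fin 2) K8) (hN : N.1.trace = 1) (hN' : N'.1.trace = 1) :
      ofGL M * ofGL N = ofGL N' * ofGL M ↔ M.1 * N.1 = N'.1 * M.1 := by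
    constructor
    · intro h
      have h1 : ofGL (M * N * M⁻¹) = ofGL N' := by
        rw [map_mul, map_mul, h, map_inv, mul_inv_cancel_right]
      have h2 := eq_of_ofGL_eq
        (by rw [Units.val_mul, Units.val_mul, Matrix.trace_units_conj, hN]) hN' h1
      exact congrArg Units.val (mul_inv_eq_iff_eq_mul.1 h2)
    · intro h
      rw [← map_mul, ← map_mul]
      exact congrArg ofGL (Units.ext h)
  rw [Conj, elt, elt, ← map_inv, key _ _ x.trace_mat y.trace_mat,
    key _ _ x.trace_mat y.trace_mat_add_one]
  rfl

/-! ### Double transitivity on the 28 points -/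

/-- A matrix with nonzero determinant which conjugates the subgroup attached to `x` to the one
attached to `y`. -/
def MatConj (A : Matrix (Fin 2) (Fin 2) K8) (x y : UnitalPoint) : Prop :=
  A 0 0 * A 1 1 - A 0 1 * A 1 0 ≠ 0 ∧ (A * x.mat = y.mat * A ∨ A * x.mat = (y.mat + 1) * A)

instance (A : Matrix (Fin 2) (Fin 2) K8) (x y : UnitalPoint) : Decidable (MatConj A x y) :=
  inferInstanceAs (Decidable (_ ∧ _))

theorem MatConj.exists_smul_eq {A : Matrix (Fin 2) (Fin 2) K8} {x y : UnitalPoint}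
    (h : MatConj A x y) : ∃ g : GL (Fin 2) K8, g.1 = A ∧ ofGL g • x = y :=
  ⟨Matrix.GeneralLinearGroup.mkOfDetNeZero A (by rw [Matrix.det_fin_two]; exact h.1), rfl,
    smul_eq_iff.2 ((conj_ofGL_iff _ _ _).2 h.2)⟩

/-- The columns are the first basis vector and its image under `x.mat`. In this cyclic basis `x.mat`
becomes the companion matrix of X² + X + 1, which is the matrix of the point (1, 1). -/
theorem matConj_of_root : ∀ x : UnitalPoint, MatConj !![1, x.root; 0, x.1.2] (pt 1 1) x := by
  decide +kernel

/-- The matrix is a + m, with m the matrix of the point (1, 1), and so commutes with m. Its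
determinant a² + a + 1 has no root in the field with eight elements. -/
theorem matConj_base : ∀ a : K8, MatConj !![a, 1; 1, a + 1] (pt 1 1) (pt 1 1) := by
  decide +kernel

/-- Modulo scalars, the matrices a + m and the identity form a cyclic group of order nine. The three
Frobenius images of (1, 3) represent its orbits on the 27 remaining points. -/
theorem exists_matConj_of_ne : ∀ y : UnitalPoint, pt 1 1 ≠ y → ∃ (k : Fin 3) (a : K8),
    MatConj !![a, 1; 1, a + 1] (frob^[k] (pt 1 3)) y ∨ frob^[k] (pt 1 3) = y := by
  decide +kernel

theorem exists_smul_eq_of_ne {y : UnitalPoint} (hy : pt 1 1 ≠ y) :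
    ∃ g : PGammaL28, g • pt 1 1 = pt 1 1 ∧ g • pt 1 3 = y := by
  obtain ⟨k, a, h⟩ := exists_matConj_of_ne y hy
  have hfrob : ∀ k : Fin 3, frob^[k] (pt 1 1) = pt 1 1 := by decide
  have hk (x : UnitalPoint) : frobeniusElt ^ (k : ℕ) • x = frob^[k] x :=
    smul_eq_iff.2 (conj_frobeniusElt_pow k x)
  rcases h with h | h
  · obtain ⟨u, hu, hu'⟩ := (matConj_base a).exists_smul_eq
    obtain ⟨v, hv, hv'⟩ := h.exists_smul_eq
    obtain rfl : u = v := Units.ext (hu.trans hv.symm)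
    exact ⟨ofGL u * frobeniusElt ^ (k : ℕ), by rw [mul_smul, hk, hfrob, hu'],
      by rw [mul_smul, hk, hv']⟩
  · exact ⟨frobeniusElt ^ (k : ℕ), by rw [hk, hfrob], by rw [hk, h]⟩

theorem doublyTransitiveAt : DoublyTransitiveAt PGammaL28 (pt 1 1) (pt 1 3) := by
  refine ⟨by decide, fun x y hxy => ?_⟩
  obtain ⟨g, -, hg⟩ := (matConj_of_root x).exists_smul_eq
  have hy : pt 1 1 ≠ (ofGL g)⁻¹ • y := by
    intro h
    rw [eq_inv_smul_iff, hg] at h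
    exact hxy h
  obtain ⟨u, hu, hu'⟩ := exists_smul_eq_of_ne hy
  exact ⟨ofGL g * u, by rw [mul_smul, hu, hg], by rw [mul_smul, hu', smul_inv_smul]⟩

theorem card_eq : Nat.card UnitalPoint = 28 := by
  rw [Nat.card_eq_fintype_card]
  decide +kernel

/-! ### Involutions and the lines of their fixed points -/

/-- The traceless matrix with the given entries. -/
def tracelessMat (p q r : K8) : Matrix (Fin 2) (Fin 2) K8 := !![p, q; r, p]

theorem ofGL_eq_one_of_traceless_mul_self {M : GL (Fin 2) K8} {p q r : K8}
    (hM : M.1 = tracelessMat p q r) : ofGL M * ofGL M = 1 := by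
  rw [← map_mul]
  refine ofGL_eq_one_of_smul (s := p * p + q * r) ?_
  rw [Units.val_mul, hM]
  have h (a b : K8) : a * b + b * a = 0 := by rw [mul_comm b, CharTwo.add_self_eq_zero]
  ext i j
  fin_cases i <;> fin_cases j <;>
    simp [tracelessMat, Matrix.mul_apply, Fin.sum_univ_two, h]
  ring

theorem orderOf_ofGL_of_traceless {M : GL (Fin 2) K8} {p q r : K8}
    (hM : M.1 = tracelessMat p q r) (hqr : q ≠ 0 ∨ r ≠ 0) : orderOf (ofGL M) = 2 := by
  refine orderOf_eq_prime ((sq _).trans (ofGL_eq_one_of_traceless_mul_self hM)) fun h => ?_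
  obtain ⟨s, hs⟩ := exists_smul_of_ofGL_eq_one h
  rw [hM] at hs
  have h01 := congrFun (congrFun hs 0) 1
  have h10 := congrFun (congrFun hs 1) 0
  simp [tracelessMat] at h01 h10
  simp [h01, h10] at hqr

/-- The involutions of `PΓL(2,8)` are induced by matrices of trace zero. -/
theorem exists_traceless_of_orderOf {t : PGammaL28} (ht : orderOf t = 2) :
    ∃ (M : GL (Fin 2) K8) (p q r : K8), t = ofGL M ∧ M.1 = tracelessMat p q r ∧
      (q ≠ 0 ∨ r ≠ 0) ∧ p * p ≠ q * r := by
  obtain ⟨ht2, ht1⟩ := (orderOf_eq_prime_iff (p := 2)).1 ht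
  obtain ⟨M, hM⟩ := exists_pow_three_eq_ofGL t
  rw [pow_succ, ht2, one_mul] at hM
  rw [hM, sq, ← map_mul] at ht2
  obtain ⟨s, hs⟩ := exists_smul_of_ofGL_eq_one ht2
  -- If the square is scalar, an off-diagonal entry that is nonzero forces trace zero; if both
  -- vanish, then p² = u², and squaring is injective.
  have key : ∀ p q r u : K8, p * q + q * u = 0 → r * p + u * r = 0 →
      p * p + q * r = r * q + u * u → u = p := by decide +kernel
  have hs' (i j) := congrFun (congrFun hs i) j
  simp only [Units.val_mul, Matrix.mul_apply, Fin.sum_univ_two, Matrix.smul_apply] at hs'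
  have h11 : M.1 1 1 = M.1 0 0 := key _ _ _ _ ((hs' 0 1).trans (by simp))
    ((hs' 1 0).trans (by simp)) ((hs' 0 0).trans ((hs' 1 1).trans (by simp)).symm)
  have hM' : M.1 = tracelessMat (M.1 0 0) (M.1 0 1) (M.1 1 0) := by
    ext i j
    fin_cases i <;> fin_cases j
    exacts [rfl, rfl, rfl, h11]
  refine ⟨M, _, _, _, hM, hM', ?_, ?_⟩
  · by_contra! h
    apply ht1
    rw [hM]
    refine ofGL_eq_one_of_smul (s := M.1 0 0) ?_
    ext i j
    fin_cases i <;> fin_cases j <;> simp [h.1, h.2, h11]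
  · intro h
    have hdet : M.1.det = 0 := by
      rw [Matrix.det_fin_two, h11, h, sub_self]
    exact (M.1.isUnit_iff_isUnit_det.1 M.isUnit).ne_zero hdet

/-- Commuting with `x.mat` would force q = r = 0, so an involution that fixes x inverts `x.mat`. Of
the four resulting equations only the vanishing of the trace of the product remains, and it is
linear in the coordinates of x. -/
theorem ofGL_smul_eq_self_iff {M : GL (Fin 2) K8} {p q r : K8}
    (hM : M.1 = tracelessMat p q r) (hqr : q ≠ 0 ∨ r ≠ 0) (x : UnitalPoint) :
    ofGL M • x = x ↔ ![p, q, r] ⬝ᵥ x.coord = 0 := by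
  have key : ∀ (p q r : K8), (q ≠ 0 ∨ r ≠ 0) → ∀ x : UnitalPoint,
      ((p * x.root + q * x.1.2 = x.root * p + x.1.1 * r ∧
        p * x.1.1 + q * (x.root + 1) = x.root * q + x.1.1 * p ∧
        r * x.root + p * x.1.2 = x.1.2 * p + (x.root + 1) * r ∧
        r * x.1.1 + p * (x.root + 1) = x.1.2 * q + (x.root + 1) * p) ∨
      (p * x.root + q * x.1.2 = (x.root + 1) * p + x.1.1 * r ∧
        p * x.1.1 + q * (x.root + 1) = (x.root + 1) * q + x.1.1 * p ∧
        r * x.root + p * x.1.2 = x.1.2 * p + (x.root + 1 + 1) * r ∧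
        r * x.1.1 + p * (x.root + 1) = x.1.2 * q + (x.root + 1 + 1) * p)) ↔
      p * 1 + q * x.1.2 + r * x.1.1 = 0 := by
    intro p q r hqr x
    have h2 (a : K8) : a + a = 0 := CharTwo.add_self_eq_zero a
    constructor
    · rintro (⟨-, hq, hr, -⟩ | ⟨h, -, -, -⟩)
      · have hq0 : q = 0 := by linear_combination hq
        have hr0 : r = 0 := by linear_combination -hr
        simp [hq0, hr0] at hqr
      · linear_combination h + h2 p + h2 (r * x.1.1)
    · intro h
      right
      refine ⟨?_, ?_, ?_, ?_⟩
      · linear_combination h - h2 p - h2 (r * x.1.1)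
      · ring
      · linear_combination -h2 r
      · linear_combination h - h2 (x.1.2 * q) - h2 p
  have hdot : ![p, q, r] ⬝ᵥ x.coord = p * 1 + q * x.1.2 + r * x.1.1 := by
    simp [dotProduct, Fin.sum_univ_three, coord]
  rw [smul_eq_iff, conj_ofGL_iff, hM, hdot, ← key p q r hqr x]
  simp only [tracelessMat, mat, Matrix.one_fin_two, ← Matrix.ext_iff, Fin.forall_fin_two,
    Matrix.mul_apply, Fin.sum_univ_two, Matrix.add_apply]
  simp [and_assoc]

theorem card_PGammaL28 : Nat.card PGammaL28 = 1512 := by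
  have h := doublyTransitiveAt.card_mul_card_stabilizer
  rw [card_eq] at h
  have hle := card_le
  have h2 : 2 ≤ Nat.card (MulAction.stabilizer PGammaL28 (pt 1 1, pt 1 3)) := by
    -- The base points (1, 1) and (1, 3) lie on the line b = 1, with coordinates (1, 0, 1); its
    -- involution gives the missing factor 2 in 756 · 2 = 1512.
    let M : GL (Fin 2) K8 := Matrix.GeneralLinearGroup.mkOfDetNeZero (tracelessMat 1 0 1)
      (by rw [tracelessMat, Matrix.det_fin_two_of]; decide)
    have hM : M.1 = tracelessMat 1 0 1 := rfl
    have hfix : ofGL M ∈ MulAction.stabilizer PGammaL28 (pt 1 1, pt 1 3) := by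
      have h11 : ![1, 0, 1] ⬝ᵥ (pt 1 1).coord = 0 := by decide
      have h13 : ![1, 0, 1] ⬝ᵥ (pt 1 3).coord = 0 := by decide
      exact Prod.ext ((ofGL_smul_eq_self_iff hM (Or.inr one_ne_zero) _).2 h11)
        ((ofGL_smul_eq_self_iff hM (Or.inr one_ne_zero) _).2 h13)
    have hone : ofGL M ≠ 1 := by
      intro h
      have := orderOf_ofGL_of_traceless hM (Or.inr one_ne_zero)
      rw [h, orderOf_one] at this
      omega
    have : Nontrivial (MulAction.stabilizer PGammaL28 (pt 1 1, pt 1 3)) :=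
      ⟨⟨_, hfix⟩, 1, fun h => hone (congrArg Subtype.val h)⟩
    exact Finite.one_lt_card
  omega

end UnitalPoint

/-! ### Transfer along an isomorphism of fields -/

namespace PGammaL

open Projectivization

variable {K K' n : Type*} [Field K] [Field K']

/-- Application of a field isomorphism to the coordinates, as a semilinear map. -/
def coordMap (θ : K ≃+* K') : (n → K) →ₛₗ[(θ : K →+* K')] (n → K') where
  toFun v i := θ (v i)
  map_add' u v := by ext i; simp
  map_smul' c v := by ext i; simp

theorem coordMap_injective (θ : K ≃+* K') : Function.Injective (coordMap (n := n) θ) :=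
  fun _ _ h => funext fun i => θ.injective (congrFun h i)

/-- The bijection of projective spaces induced by a field isomorphism. -/
def projEquiv (θ : K ≃+* K') : ℙ K (n → K) ≃ ℙ K' (n → K') where
  toFun := map (coordMap θ) (coordMap_injective θ)
  invFun := map (coordMap θ.symm) (coordMap_injective θ.symm)
  left_inv x := by
    induction x with | h v hv => ?_
    simp only [map_mk]
    congr 1
    exact funext fun i => θ.symm_apply_apply (v i)
  right_inv x := by
    induction x with | h v hv => ?_
    simp only [map_mk]
    congr 1
    exact funext fun i => θ.apply_symm_apply (v i)

theorem permCongr_mem (θ : K ≃+* K') (g : PGammaL K (n → K)) :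
    (projEquiv θ).permCongr g.1 ∈ PGammaL K' (n → K') := by
  obtain ⟨g, σ, f, hf, hg⟩ := g
  let θn : (n → K) ≃+ (n → K') :=
    ⟨⟨fun v i => θ (v i), fun v i => θ.symm (v i), fun v => by simp, fun v => by simp⟩,
      fun u v => by ext i; simp⟩
  refine ⟨(θ.symm.trans σ).trans θ, (θn.symm.trans f).trans θn, fun c v => ?_, fun v hv => ?_⟩
  · have h : θn.symm (c • v) = θ.symm c • θn.symm v := by
      ext i
      exact map_mul θ.symm c (v i)
    have h' (a : K) (u : n → K) : θn (a • u) = θ a • θn u := by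
      ext i
      exact map_mul θ a (u i)
    simp only [AddEquiv.trans_apply, RingEquiv.coe_trans, Function.comp_apply, h, hf, h']
  · exact congrArg (projEquiv θ) (hg (θn.symm v) (θn.symm.map_ne_zero_iff.2 hv))

/-- Isomorphic fields have isomorphic projective semilinear groups. -/
def congr (θ : K ≃+* K') : PGammaL K (n → K) ≃* PGammaL K' (n → K') where
  toFun g := ⟨(projEquiv θ).permCongr g.1, permCongr_mem θ g⟩
  invFun g := ⟨(projEquiv θ.symm).permCongr g.1, permCongr_mem θ.symm g⟩
  left_inv g := Subtype.ext ((projEquiv (n := n) θ).permCongr.symm_apply_apply g.1)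
  right_inv g := Subtype.ext ((projEquiv (n := n) θ).permCongr.apply_symm_apply g.1)
  map_mul' g h := Subtype.ext (by ext x; simp)

end PGammaL

/-! ### Coordinates for the Ree unital -/

namespace UnitalPoint

/-- The line with the given coordinates is a block of the unital, that is, the involution with the
given entries exists. -/
def IsBlock (u : Fin 3 → K8) : Prop := (u 1 ≠ 0 ∨ u 2 ≠ 0) ∧ u 0 * u 0 ≠ u 1 * u 2

instance (u : Fin 3 → K8) : Decidable (IsBlock u) := inferInstanceAs (Decidable (_ ∧ _))

/-- The bijection `e` identifies the blocks of the Ree unital with the lines in its model. -/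
def IsCoordinatization (e : ReeUnitalPoint ≃ UnitalPoint) : Prop :=
  ∀ S : Set ReeUnitalPoint, (∃ t : Ree3, orderOf t = 2 ∧ S = MulAction.fixedBy ReeUnitalPoint t) ↔
    ∃ u, IsBlock u ∧ S = {P | u ⬝ᵥ (e P).coord = 0}

/-- An isomorphism of fields transports the action to `Ree3`. Its equivariant bijection with the
Sylow subgroups turns fixed points of involutions into points of lines. -/
theorem exists_isCoordinatization : ∃ e, IsCoordinatization e := by
  classical
  have hcard : Fintype.card K8 = Nat.card (GaloisField 2 3) := by
    rw [GaloisField.card 2 3 (by norm_num), K8.card_eq]; norm_num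
  let _ : Fintype (GaloisField 2 3) := Fintype.ofFinite _
  let θ : GaloisField 2 3 ≃+* K8 :=
    FiniteField.ringEquivOfCardEq (by rw [hcard, Nat.card_eq_fintype_card])
  let E : Ree3 ≃* PGammaL28 := PGammaL.congr θ
  let _ : MulAction Ree3 UnitalPoint := MulAction.compHom UnitalPoint E.toMonoidHom
  have hsmul (g : Ree3) (x : UnitalPoint) : g • x = E g • x := rfl
  have h2 : DoublyTransitiveAt Ree3 (pt 1 1) (pt 1 3) := by
    refine ⟨doublyTransitiveAt.1, fun x y hxy => ?_⟩
    obtain ⟨g, hg, hg'⟩ := doublyTransitiveAt.2 x y hxy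
    exact ⟨E.symm g, by rw [hsmul, E.apply_symm_apply, hg], by rw [hsmul, E.apply_symm_apply, hg']⟩
  obtain ⟨e, he⟩ := h2.exists_equiv_sylow card_eq
    (by rw [Nat.card_congr E.toEquiv, card_PGammaL28])
  have hfix (t : Ree3) {M : GL (Fin 2) K8} {u : Fin 3 → K8} (ht : E t = PGammaL28.ofGL M)
      (hM : M.1 = tracelessMat (u 0) (u 1) (u 2)) (hu : u 1 ≠ 0 ∨ u 2 ≠ 0) :
      MulAction.fixedBy ReeUnitalPoint t = {P | u ⬝ᵥ (e P).coord = 0} := by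
    ext P
    have hu' : u = ![u 0, u 1, u 2] := by ext i; fin_cases i <;> rfl
    rw [MulAction.mem_fixedBy, Set.mem_ofPred_eq, hu', ← ofGL_smul_eq_self_iff hM hu, ← ht, ← hsmul,
      ← he, e.apply_eq_iff_eq]
  refine ⟨e, fun S => ⟨?_, ?_⟩⟩
  · rintro ⟨t, ht, rfl⟩
    obtain ⟨M, p, q, r, hM, hM', hqr, hp⟩ := exists_traceless_of_orderOf
      (t := E t) (by rw [MulEquiv.orderOf_eq, ht])
    exact ⟨![p, q, r], ⟨hqr, hp⟩, hfix t hM hM' hqr⟩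
  · rintro ⟨u, ⟨hu, hu'⟩, rfl⟩
    let M : GL (Fin 2) K8 := Matrix.GeneralLinearGroup.mkOfDetNeZero
      (tracelessMat (u 0) (u 1) (u 2))
      (by rw [tracelessMat, Matrix.det_fin_two_of]; exact sub_ne_zero.2 hu')
    refine ⟨E.symm (PGammaL28.ofGL M), ?_, (hfix _ (E.apply_symm_apply _) rfl hu).symm⟩
    rw [MulEquiv.orderOf_eq]
    exact orderOf_ofGL_of_traceless (M := M) rfl hu

end UnitalPoint

/-! ### Embeddings and subplanes -/

section Incidence

theorem permCongr_ofInjective_apply {α β : Type*} {f : α → β} (hf : Function.Injective f)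
    (γ : α ≃ α) (a : α) :
    (Equiv.ofInjective f hf).permCongr γ (Equiv.ofInjective f hf a) =
      Equiv.ofInjective f hf (γ a) := by
  rw [Equiv.permCongr_apply, Equiv.symm_apply_apply]

variable {P L P' L' : Type*} [Membership P L] [Membership P' L']

/-- An embedding which is bijective on points and lines, as an automorphism. -/
noncomputable def IncidenceEmbedding.toAut (E : IncidenceEmbedding P L P L)
    (hp : Function.Surjective E.point) (hl : Function.Surjective E.line) : IncidenceAut P L where
  point := Equiv.ofBijective E.point ⟨E.point_injective, hp⟩
  line := Equiv.ofBijective E.line ⟨E.line_injective, hl⟩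
  mem_iff := E.mem_iff

variable (E : IncidenceEmbedding P L P' L')

/-- The image of a projective plane under an embedding is a projective plane. -/
@[reducible]
noncomputable def IncidenceEmbedding.rangePlane [ProjectivePlane P L] :
    @ProjectivePlane (Set.range E.point) (Set.range E.line)
      (inducedMembership (Set.range E.point) (Set.range E.line)) := by
  letI := inducedMembership (Set.range E.point) (Set.range E.line)
  let ep := Equiv.ofInjective E.point E.point_injective
  let el := Equiv.ofInjective E.line E.line_injective
  have hep (p : Set.range E.point) : E.point (ep.symm p) = p :=
    Equiv.apply_ofInjective_symm E.point_injective p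
  have hel (l : Set.range E.line) : E.line (el.symm l) = l :=
    Equiv.apply_ofInjective_symm E.line_injective l
  have hmem (p : Set.range E.point) (l : Set.range E.line) :
      p ∈ l ↔ ep.symm p ∈ el.symm l := by
    rw [← E.mem_iff, hep, hel]
    rfl
  have hmem' (p : P) (l : L) : ep p ∈ el l ↔ p ∈ l := by
    rw [hmem, ep.symm_apply_apply, el.symm_apply_apply]
  have hp {p q : Set.range E.point} (h : p ≠ q) : ep.symm p ≠ ep.symm q :=
    fun h' => h (ep.symm.injective h')
  have hl {p q : Set.range E.line} (h : p ≠ q) : el.symm p ≠ el.symm q :=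
    fun h' => h (el.symm.injective h')
  exact
    { exists_point := fun l => by
        obtain ⟨p, hp⟩ := Nondegenerate.exists_point (P := P) (el.symm l)
        exact ⟨ep p, by rwa [hmem, ep.symm_apply_apply]⟩
      exists_line := fun p => by
        obtain ⟨l, hl⟩ := Nondegenerate.exists_line (L := L) (ep.symm p)
        exact ⟨el l, by rwa [hmem, el.symm_apply_apply]⟩
      eq_or_eq := fun h₁ h₂ h₃ h₄ => by
        rw [hmem] at h₁ h₂ h₃ h₄
        exact (Nondegenerate.eq_or_eq h₁ h₂ h₃ h₄).imp (fun h => ep.symm.injective h)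
          (fun h => el.symm.injective h)
      mkPoint := fun h => ep (HasPoints.mkPoint (hl h))
      mkPoint_ax := fun h => by
        rw [hmem, hmem, ep.symm_apply_apply]
        exact HasPoints.mkPoint_ax (hl h)
      mkLine := fun h => el (HasLines.mkLine (hp h))
      mkLine_ax := fun h => by
        rw [hmem, hmem, el.symm_apply_apply]
        exact HasLines.mkLine_ax (hp h)
      exists_config := by
        obtain ⟨p₁, p₂, p₃, l₁, l₂, l₃, h⟩ := ProjectivePlane.exists_config (P := P) (L := L)
        refine ⟨ep p₁, ep p₂, ep p₃, el l₁, el l₂, el l₃, ?_⟩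
        simpa only [hmem'] using h }

/-- The image of a projective plane under an embedding, as a subplane. -/
noncomputable def IncidenceEmbedding.rangeSubplane [ProjectivePlane P L] : Subplane P' L' where
  points := Set.range E.point
  lines := Set.range E.line
  plane := E.rangePlane

theorem IncidenceEmbedding.card_rangeSubplane [ProjectivePlane P L] [Finite P] [Finite L] :
    E.rangeSubplane.order ^ 2 + E.rangeSubplane.order + 1 = Nat.card P := by
  have hf : Finite (Set.range E.point) := Set.finite_range _
  have hf' : Finite (Set.range E.line) := Set.finite_range _
  have hf'' := Fintype.ofFinite (Set.range E.point)
  rw [Nat.card_congr (Equiv.ofInjective E.point E.point_injective), Nat.card_eq_fintype_card]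
  exact (@ProjectivePlane.card_points _ _ (inducedMembership (Set.range E.point)
    (Set.range E.line)) E.rangePlane _ _).symm

/-- A collineation of a projective plane, transported to its image under an embedding. -/
noncomputable def IncidenceAut.onRange [ProjectivePlane P L] (γ : IncidenceAut P L) :
    IncidenceAut E.rangeSubplane.points E.rangeSubplane.lines where
  point := (Equiv.ofInjective E.point E.point_injective).permCongr γ.point
  line := (Equiv.ofInjective E.line E.line_injective).permCongr γ.line
  mem_iff p l := by
    obtain ⟨p, rfl⟩ := (Equiv.ofInjective E.point E.point_injective).surjective p
    obtain ⟨l, rfl⟩ := (Equiv.ofInjective E.line E.line_injective).surjective l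
    have hp := permCongr_ofInjective_apply E.point_injective γ.point p
    have hl := permCongr_ofInjective_apply E.line_injective γ.line l
    change (((Equiv.ofInjective E.point E.point_injective).permCongr γ.point
        (Equiv.ofInjective E.point E.point_injective p) : Set.range E.point) : P') ∈
      (((Equiv.ofInjective E.line E.line_injective).permCongr γ.line
        (Equiv.ofInjective E.line E.line_injective l) : Set.range E.line) : L') ↔
      E.point p ∈ E.line l
    rw [hp, hl]
    exact (E.mem_iff _ _).trans ((γ.mem_iff p l).trans (E.mem_iff _ _).symm)

theorem IncidenceAut.onRange_apply [ProjectivePlane P L] (γ : IncidenceAut P L) {p : P}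
    {q : E.rangeSubplane.points} (hq : (q : P') = E.point p) :
    ((γ.onRange E).point q : P') = E.point (γ.point p) := by
  have : q = Equiv.ofInjective E.point E.point_injective p := Subtype.ext hq
  rw [this]
  exact congrArg Subtype.val (permCongr_ofInjective_apply E.point_injective γ.point p)

end Incidence

/-! ### Semilinear embeddings of classical planes -/

namespace PGEmbedding

open Projectivization

variable {K F : Type*} [Field K] [Field F]

/-- The semilinear map given by a field homomorphism and a matrix. -/
def matMap (ι : K →+* F) (A : Matrix (Fin 3) (Fin 3) F) : (Fin 3 → K) →ₛₗ[ι] (Fin 3 → F) where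
  toFun v := A.mulVec (ι ∘ v)
  map_add' u v := by
    rw [← Matrix.mulVec_add]
    congr 1
    ext i
    simp
  map_smul' c v := by
    rw [← Matrix.mulVec_smul]
    congr 1
    ext i
    simp

theorem matMap_injective (ι : K →+* F) {A : Matrix (Fin 3) (Fin 3) F} (hA : A.det ≠ 0) :
    Function.Injective (matMap ι A) := fun _ _ h => funext fun i => ι.injective <|
  congrFun (Matrix.mulVec_injective_of_isUnit
    ((Matrix.isUnit_iff_isUnit_det A).2 (isUnit_iff_ne_zero.2 hA)) h) i

/-- Since ι need not be surjective, proportionality over F has to be brought back to K. Triple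
products do this: they are transported by ι up to the factor det A. -/
theorem map_matMap_injective (ι : K →+* F) {A : Matrix (Fin 3) (Fin 3) F} (hA : A.det ≠ 0) :
    Function.Injective (map (matMap ι A) (matMap_injective ι hA)) := by
  intro p q h
  induction p using Projectivization.ind with | h v hv => ?_
  induction q using Projectivization.ind with | h w hw => ?_
  rw [map_mk, map_mk, mk_eq_mk_iff_crossProduct_eq_zero] at h
  rw [mk_eq_mk_iff_crossProduct_eq_zero]
  refine dotProduct_eq_zero _ fun z => ?_
  have hz : tripleProduct (A.mulVec (ι ∘ v)) (A.mulVec (ι ∘ w)) (A.mulVec (ι ∘ z)) = 0 := by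
    rw [tripleProduct_eq_cross_dot]
    exact (congrArg (· ⬝ᵥ A.mulVec (ι ∘ z)) h).trans (zero_dotProduct _)
  rw [tripleProduct_mulVec, tripleProduct_map] at hz
  rw [← tripleProduct_eq_cross_dot]
  exact (map_eq_zero ι).1 ((mul_eq_zero.1 hz).resolve_left hA)

theorem det_inv_transpose_ne_zero {A : Matrix (Fin 3) (Fin 3) F} (hA : A.det ≠ 0) :
    (A⁻¹.transpose).det ≠ 0 := by
  rw [Matrix.det_transpose, Matrix.det_nonsing_inv, Ring.inverse_eq_inv']
  exact inv_ne_zero hA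

/-- The embedding of `PG(2,K)` in `PG(2,F)` given by a field homomorphism and an invertible
matrix. -/
noncomputable def ofMatrix (ι : K →+* F) (A : Matrix (Fin 3) (Fin 3) F) (hA : A.det ≠ 0) :
    IncidenceEmbedding (PGPoint K) (PGLine K) (PGPoint F) (PGLine F) where
  point := map (matMap ι A) (matMap_injective ι hA)
  -- The inverse transpose is the contragredient action, which preserves the pairing of points with
  -- lines.
  line := map (matMap ι A⁻¹.transpose) (matMap_injective ι (det_inv_transpose_ne_zero hA))
  point_injective := map_matMap_injective ι hA
  line_injective := map_matMap_injective ι (det_inv_transpose_ne_zero hA)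
  mem_iff p l := by
    induction p using Projectivization.ind with | h v hv => ?_
    induction l using Projectivization.ind with | h u hu => ?_
    rw [map_mk, map_mk]
    change A.mulVec (ι ∘ v) ⬝ᵥ A⁻¹.transpose.mulVec (ι ∘ u) = 0 ↔ v ⬝ᵥ u = 0
    rw [Matrix.dotProduct_mulVec, Matrix.vecMul_transpose, Matrix.mulVec_mulVec,
      Matrix.nonsing_inv_mul _ (isUnit_iff_ne_zero.2 hA), Matrix.one_mulVec,
      ← RingHom.map_dotProduct ι, map_eq_zero]

theorem matMap_surjective {ι : K →+* F} (hι : Function.Surjective ι)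
    {A : Matrix (Fin 3) (Fin 3) F} (hA : A.det ≠ 0) : Function.Surjective (matMap ι A) := by
  intro w
  choose v hv using fun i => hι (A⁻¹.mulVec w i)
  refine ⟨v, ?_⟩
  change A.mulVec (ι ∘ v) = w
  rw [show ι ∘ v = A⁻¹.mulVec w from funext hv, Matrix.mulVec_mulVec,
    Matrix.mul_nonsing_inv _ (isUnit_iff_ne_zero.2 hA), Matrix.one_mulVec]

theorem map_matMap_surjective {ι : K →+* F} (hι : Function.Surjective ι)
    {A : Matrix (Fin 3) (Fin 3) F} (hA : A.det ≠ 0) :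
    Function.Surjective (map (matMap ι A) (matMap_injective ι hA)) := by
  intro p
  induction p using Projectivization.ind with | h w hw => ?_
  obtain ⟨v, rfl⟩ := matMap_surjective hι hA w
  exact ⟨mk K v fun h => hw (by rw [h, map_zero]), rfl⟩

/-- The collineation of `PG(2,F)` given by a surjective endomorphism of `F` and an invertible
matrix. -/
noncomputable def autOfMatrix {σ : F →+* F} (hσ : Function.Surjective σ)
    (A : Matrix (Fin 3) (Fin 3) F) (hA : A.det ≠ 0) : IncidenceAut (PGPoint F) (PGLine F) :=
  (ofMatrix σ A hA).toAut (map_matMap_surjective hσ hA)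
    (map_matMap_surjective hσ (det_inv_transpose_ne_zero hA))

theorem autOfMatrix_point {σ : F →+* F} (hσ : Function.Surjective σ)
    (A : Matrix (Fin 3) (Fin 3) F) (hA : A.det ≠ 0) (p : PGPoint F) :
    (autOfMatrix hσ A hA).point p = (ofMatrix σ A hA).point p := rfl

/-- Composition of semilinear embeddings. -/
theorem ofMatrix_ofMatrix {K' : Type*} [Field K'] {s : K →+* K'} {C : Matrix (Fin 3) (Fin 3) K'}
    {hC : C.det ≠ 0} {ι : K' →+* F} {A : Matrix (Fin 3) (Fin 3) F} {hA : A.det ≠ 0}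
    {κ : K →+* F} {D : Matrix (Fin 3) (Fin 3) F} {hD : D.det ≠ 0} (hκ : κ = ι.comp s)
    (h : D = A * C.map ι) (p : PGPoint K) :
    (ofMatrix ι A hA).point ((ofMatrix s C hC).point p) = (ofMatrix κ D hD).point p := by
  subst hκ h
  induction p using Projectivization.ind with | h v hv => ?_
  change mk F _ _ = mk F _ _
  congr 1
  change A.mulVec (ι ∘ C.mulVec (s ∘ v)) = (A * C.map ι).mulVec (ι ∘ s ∘ v)
  rw [← Matrix.mulVec_mulVec]
  congr 1
  ext i
  exact RingHom.map_mulVec ι C _ i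

theorem isProjectiveLinear_autOfMatrix (A : Matrix (Fin 3) (Fin 3) F) (hA : A.det ≠ 0) :
    IsProjectiveLinear (autOfMatrix (σ := RingHom.id F) Function.surjective_id A hA) := by
  refine ⟨.mk (Matrix.GeneralLinearGroup.mkOfDetNeZero A hA), fun p => ?_⟩
  induction p using Projectivization.ind with | h v hv => ?_
  rfl

end PGEmbedding

theorem line_eq_of_mem {F : Type*} [Field F] {p q : PGPoint F} (hpq : p ≠ q) {l m : PGLine F}
    (h₁ : p ∈ l) (h₂ : q ∈ l) (h₃ : p ∈ m) (h₄ : q ∈ m) : l = m :=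
  (Nondegenerate.eq_or_eq h₁ h₂ h₃ h₄).resolve_left hpq

/-! ### Blocks and automorphisms in coordinates -/

namespace UnitalPoint

open Projectivization PGEmbedding

/-- The coordinates of the line through two points. -/
def join (x y : UnitalPoint) : Fin 3 → K8 :=
  ![x.coord 1 * y.coord 2 - x.coord 2 * y.coord 1,
    x.coord 2 * y.coord 0 - x.coord 0 * y.coord 2,
    x.coord 0 * y.coord 1 - x.coord 1 * y.coord 0]

theorem join_dot (x y z : UnitalPoint) :
    join x y ⬝ᵥ z.coord = tripleProduct x.coord y.coord z.coord := by
  simp [join, tripleProduct, dotProduct, Fin.sum_univ_three]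
  ring

/-- The ten excluded lines contain no point of the unital: for p² = qr a common point would give a
root of a quadratic polynomial that is irreducible because bc has trace one. -/
theorem isBlock_join : ∀ x y : UnitalPoint, x ≠ y → IsBlock (join x y) := by
  decide +kernel

theorem exists_two_of_isBlock {u : Fin 3 → K8} (hu : IsBlock u) :
    ∃ x y : UnitalPoint, x ≠ y ∧ u ⬝ᵥ x.coord = 0 ∧ u ⬝ᵥ y.coord = 0 := by
  have key : ∀ p q r : K8, IsBlock ![p, q, r] → ∃ x : UnitalPoint,
      p * 1 + q * x.1.2 + r * x.1.1 = 0 ∧ ∃ y, x ≠ y ∧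
        p * 1 + q * y.1.2 + r * y.1.1 = 0 := by decide +kernel
  obtain ⟨x, hx, y, hxy, hy⟩ := key (u 0) (u 1) (u 2) hu
  exact ⟨x, y, hxy, by simpa [dotProduct, Fin.sum_univ_three, coord] using hx,
    by simpa [dotProduct, Fin.sum_univ_three, coord] using hy⟩

/-- The point of `PG(2,8)` with the given coordinates. -/
def std (x : UnitalPoint) : PGPoint K8 := mk K8 x.coord x.coord_ne_zero

theorem tripleProduct_self_left {R : Type*} [CommRing R] (u v : Fin 3 → R) :
    tripleProduct u u v = 0 := by
  simp [tripleProduct]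
  ring

variable {e : ReeUnitalPoint ≃ UnitalPoint}

theorem IsCoordinatization.exists_mem_iff (he : IsCoordinatization e) (B : ReeUnitalBlock) :
    ∃ u, IsBlock u ∧ ∀ P, P ∈ B ↔ u ⬝ᵥ (e P).coord = 0 := by
  obtain ⟨u, hu, h⟩ := (he B.1).1 B.2
  exact ⟨u, hu, fun P => by
    change P ∈ B.1 ↔ _
    rw [h]
    rfl⟩

theorem IsCoordinatization.exists_two_mem (he : IsCoordinatization e) (B : ReeUnitalBlock) :
    ∃ P Q, P ≠ Q ∧ P ∈ B ∧ Q ∈ B := by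
  obtain ⟨u, hu, h⟩ := he.exists_mem_iff B
  obtain ⟨x, y, hxy, hx, hy⟩ := exists_two_of_isBlock hu
  exact ⟨e.symm x, e.symm y, fun h => hxy (e.symm.injective h), (h _).2 (by simpa using hx),
    (h _).2 (by simpa using hy)⟩

theorem IsCoordinatization.exists_block (he : IsCoordinatization e) {P Q : ReeUnitalPoint}
    (hPQ : P ≠ Q) : ∃ B : ReeUnitalBlock,
      ∀ R, R ∈ B ↔ tripleProduct (e P).coord (e Q).coord (e R).coord = 0 := by
  refine ⟨⟨_, (he _).2 ⟨join (e P) (e Q), isBlock_join _ _ (e.injective.ne hPQ), rfl⟩⟩,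
    fun R => ?_⟩
  rw [← join_dot]
  rfl

/-- The image of a block is the only line which contains the images of its points. -/
theorem IsCoordinatization.line_eq (he : IsCoordinatization e) {F : Type*} [Field F]
    (φ : ReeUnitalEmbedding F) (B : ReeUnitalBlock) (l : PGLine F)
    (h : ∀ P, P ∈ B → φ.point P ∈ l) : φ.line B = l := by
  obtain ⟨P, Q, hPQ, hP, hQ⟩ := he.exists_two_mem B
  exact line_eq_of_mem (φ.point_injective.ne hPQ) ((φ.mem_iff _ _).2 hP) ((φ.mem_iff _ _).2 hQ)
    (h P hP) (h Q hQ)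

/-- Two points lie on a block, whose image must be the line joining their images. Incidence is
reflected as well as preserved, so a third image is on this line only if the third point is on the
block. -/
theorem IsCoordinatization.realizes (he : IsCoordinatization e) {F : Type*} [Field F]
    (φ : ReeUnitalEmbedding F) : Realizes fun x => (φ.point (e.symm x)).rep := by
  intro x y z
  by_cases hxy : x = y
  · subst hxy
    simp only [tripleProduct_self_left]
  have hPQ : e.symm x ≠ e.symm y := e.symm.injective.ne hxy
  obtain ⟨B, hB⟩ := he.exists_block hPQ
  have hBx := hB (e.symm x)
  have hBy := hB (e.symm y)
  have hBz := hB (e.symm z)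
  simp only [e.apply_symm_apply] at hBx hBy hBz
  set p := φ.point (e.symm x)
  set q := φ.point (e.symm y)
  set r := φ.point (e.symm z)
  have hpq : p ≠ q := φ.point_injective.ne hPQ
  have hcross : crossProduct p.rep q.rep ≠ 0 := by
    intro h
    rw [← mk_eq_mk_iff_crossProduct_eq_zero p.rep_nonzero q.rep_nonzero, mk_rep, mk_rep] at h
    exact hpq h
  have hmem (s : PGPoint F) : s ∈ (mk F _ hcross : PGLine F) ↔
      tripleProduct p.rep q.rep s.rep = 0 := by
    have : s = mk F s.rep s.rep_nonzero := s.mk_rep.symm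
    rw [tripleProduct_eq_cross_dot, dotProduct_comm]
    conv_lhs => rw [this]
    exact orthogonal_mk _ _
  have hl : φ.line B = mk F _ hcross := by
    have h1 : tripleProduct x.coord y.coord x.coord = 0 := by simp [tripleProduct]; ring
    have h2 : tripleProduct x.coord y.coord y.coord = 0 := by simp [tripleProduct]; ring
    refine line_eq_of_mem hpq ((φ.mem_iff _ _).2 (hBx.2 h1)) ((φ.mem_iff _ _).2 (hBy.2 h2)) ?_ ?_
    · rw [hmem]; simp [tripleProduct]; ring
    · rw [hmem]; simp [tripleProduct]; ring
  rw [← hBz, ← φ.mem_iff, hl, hmem]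

theorem Realizes.exists_ofMatrix {F : Type*} [Field F] {f : UnitalPoint → PGPoint F}
    (hf : Realizes fun x => (f x).rep) :
    ∃ (ι : K8 →+* F) (A : Matrix (Fin 3) (Fin 3) F) (hA : A.det ≠ 0),
      ∀ x, f x = (ofMatrix ι A hA).point (std x) := by
  obtain ⟨ι, A, hA, h⟩ := hf.exists_hom_matrix
  refine ⟨ι, A, hA, fun x => ?_⟩
  obtain ⟨s, hs, hs'⟩ := h x
  rw [← (f x).mk_rep]
  exact (mk_eq_mk_iff' ..).2 ⟨s, hs'.symm⟩

/-- Every embedding of the Ree unital is obtained from its coordinates in `PG(2,8)` by a semilinear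
embedding of planes. -/
theorem IsCoordinatization.exists_ofMatrix (he : IsCoordinatization e) {F : Type*} [Field F]
    (φ : ReeUnitalEmbedding F) :
    ∃ (ι : K8 →+* F) (A : Matrix (Fin 3) (Fin 3) F) (hA : A.det ≠ 0),
      ∀ P, φ.point P = (ofMatrix ι A hA).point (std (e P)) := by
  obtain ⟨ι, A, hA, h⟩ := (he.realizes φ).exists_ofMatrix
  exact ⟨ι, A, hA, fun P => by rw [← h, e.symm_apply_apply]⟩

/-- Every automorphism of the Ree unital is induced by a collineation of `PG(2,8)`. -/
theorem IsCoordinatization.exists_collineation (he : IsCoordinatization e)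
    (α : IncidenceAut ReeUnitalPoint ReeUnitalBlock) :
    ∃ (s : K8 →+* K8) (C : Matrix (Fin 3) (Fin 3) K8) (hC : C.det ≠ 0),
      ∀ P, std (e (α.point P)) = (ofMatrix s C hC).point (std (e P)) := by
  have hcol (P Q R : ReeUnitalPoint) (hPQ : P ≠ Q) :
      tripleProduct (e P).coord (e Q).coord (e R).coord = 0 ↔
        ∃ B : ReeUnitalBlock, P ∈ B ∧ Q ∈ B ∧ R ∈ B := by
    constructor
    · intro h
      obtain ⟨B, hB⟩ := he.exists_block hPQ
      refine ⟨B, (hB _).2 ?_, (hB _).2 ?_, (hB _).2 h⟩ <;> simp [tripleProduct] <;> ring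
    · rintro ⟨B, hP, hQ, hR⟩
      obtain ⟨u, hu, h⟩ := he.exists_mem_iff B
      rw [h] at hP hQ hR
      by_contra h0
      have hu0 : u = 0 := by
        have hM : (Matrix.of ![(e P).coord, (e Q).coord, (e R).coord]).mulVec u = 0 := by
          ext i
          fin_cases i
          · exact (dotProduct_comm _ _).trans hP
          · exact (dotProduct_comm _ _).trans hQ
          · exact (dotProduct_comm _ _).trans hR
        refine Matrix.eq_zero_of_mulVec_eq_zero ?_ hM
        rw [Matrix.det_fin_three]
        intro h
        apply h0
        rw [← h]
        simp [tripleProduct]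
        ring
      subst hu0
      exact hu.1.elim (fun h => h rfl) (fun h => h rfl)
  -- Collinearity has been expressed by blocks alone, so an automorphism followed by the standard
  -- coordinates is again a realization, now over `K8` itself.
  have hreal : Realizes fun x => (std (e (α.point (e.symm x)))).rep := by
    intro x y z
    by_cases hxy : x = y
    · subst hxy
      simp only [tripleProduct_self_left]
    have hrep (w : UnitalPoint) : Proportional (std w).rep w.coord := by
      obtain ⟨s, hs⟩ := exists_smul_eq_mk_rep K8 w.coord w.coord_ne_zero
      exact ⟨s, s.ne_zero, hs.symm⟩
    have htriple (a b c : UnitalPoint) :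
        tripleProduct (std a).rep (std b).rep (std c).rep = 0 ↔
          tripleProduct a.coord b.coord c.coord = 0 := by
      obtain ⟨r, hr, h⟩ := hrep a
      obtain ⟨s, hs, h'⟩ := hrep b
      obtain ⟨t, ht, h''⟩ := hrep c
      rw [h, h', h'', tripleProduct_smul]
      simp [hr, hs, ht]
    have hPQ : e.symm x ≠ e.symm y := e.symm.injective.ne hxy
    have h0 := hcol _ _ (e.symm z) hPQ
    simp only [e.apply_symm_apply] at h0
    rw [htriple, hcol _ _ _ (α.point.injective.ne hPQ), h0]
    constructor
    · rintro ⟨B, h⟩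
      obtain ⟨B, rfl⟩ := α.line.surjective B
      simp only [α.mem_iff] at h
      exact ⟨B, h⟩
    · rintro ⟨B, h⟩
      refine ⟨α.line B, ?_⟩
      simpa only [α.mem_iff] using h
  obtain ⟨s, C, hC, h⟩ := Realizes.exists_ofMatrix (f := fun x => std (e (α.point (e.symm x)))) hreal
  exact ⟨s, C, hC, fun P => by rw [← h, e.symm_apply_apply]⟩

/-- The action of field automorphisms on the points of the unital. -/
def mapEquiv (s : K8 ≃+* K8) : UnitalPoint ≃ UnitalPoint where
  toFun x := ⟨(s x.1.1, s x.1.2), by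
    have h := congrArg s x.2
    simpa [K8.trace] using h⟩
  invFun x := ⟨(s.symm x.1.1, s.symm x.1.2), by
    have h := congrArg s.symm x.2
    simpa [K8.trace] using h⟩
  left_inv x := Subtype.ext (Prod.ext (s.symm_apply_apply _) (s.symm_apply_apply _))
  right_inv x := Subtype.ext (Prod.ext (s.apply_symm_apply _) (s.apply_symm_apply _))

theorem coord_mapEquiv (s : K8 ≃+* K8) (x : UnitalPoint) :
    (mapEquiv s x).coord = s ∘ x.coord := by
  ext i
  fin_cases i
  · exact (map_one s).symm
  · rfl
  · rfl

/-- Field automorphisms induce automorphisms of the Ree unital. -/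
theorem IsCoordinatization.exists_aut (he : IsCoordinatization e) (s : K8 ≃+* K8) :
    ∃ α : IncidenceAut ReeUnitalPoint ReeUnitalBlock, ∀ P, e (α.point P) = mapEquiv s (e P) := by
  let π (s : K8 ≃+* K8) : ReeUnitalPoint ≃ ReeUnitalPoint := (e.trans (mapEquiv s)).trans e.symm
  have hπ (s : K8 ≃+* K8) (S : Set ReeUnitalPoint)
      (hS : ∃ t : Ree3, orderOf t = 2 ∧ S = MulAction.fixedBy ReeUnitalPoint t) :
      ∃ t : Ree3, orderOf t = 2 ∧ Equiv.Set.congr (π s) S = MulAction.fixedBy ReeUnitalPoint t := by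
    rw [he] at hS ⊢
    obtain ⟨u, ⟨hu, hu'⟩, rfl⟩ := hS
    -- A field automorphism acts on line coordinates entrywise and preserves the dual hyperoval.
    refine ⟨s ∘ u, ⟨by simpa using hu, ?_⟩, ?_⟩
    · intro h
      apply hu'
      apply s.injective
      simpa using h
    · ext P
      obtain ⟨P, rfl⟩ := (π s).surjective P
      rw [Equiv.Set.congr_apply, (π s).injective.mem_set_image]
      have : e (π s P) = mapEquiv s (e P) := e.apply_symm_apply _
      change u ⬝ᵥ (e P).coord = 0 ↔ (s ∘ u) ⬝ᵥ (e (π s P)).coord = 0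
      rw [this, coord_mapEquiv]
      have h := RingHom.map_dotProduct (s : K8 →+* K8) u (e P).coord
      exact (map_eq_zero_iff s s.injective).symm.trans (iff_of_eq (congrArg (· = 0) h))
  have hsymm (S : Set ReeUnitalPoint) :
      Equiv.Set.congr (π s.symm) (Equiv.Set.congr (π s) S) = S :=
    (Equiv.Set.congr (π s)).symm_apply_apply S
  let lineEquiv : ReeUnitalBlock ≃ ReeUnitalBlock :=
    (Equiv.Set.congr (π s)).subtypeEquiv fun S =>
      ⟨hπ s S, fun h => by simpa only [hsymm] using hπ s.symm _ h⟩
  refine ⟨⟨π s, lineEquiv, fun P B => ?_⟩, fun P => e.apply_symm_apply _⟩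
  change π s P ∈ π s '' B.1 ↔ P ∈ B.1
  exact (π s).injective.mem_set_image

end UnitalPoint

/-! ### Homomorphisms from the field with eight elements -/

namespace K8

/-- A homomorphism from `K8` reaches all solutions of `x ^ 8 = x`. -/
theorem exists_eq_of_pow_eight {F : Type*} [Field F] (ι : K8 →+* F) {x : F} (hx : x ^ 8 = x) :
    ∃ a, ι a = x := by
  classical
  let p : Polynomial F := Polynomial.X ^ 8 - Polynomial.X
  have hdeg : p.natDegree = 8 := by
    simp only [p]
    compute_degree!
  have hp : p ≠ 0 := by
    intro h
    rw [h, Polynomial.natDegree_zero] at hdeg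
    omega
  have hroot (y : F) : y ∈ p.roots.toFinset ↔ y ^ 8 = y := by
    simp [hp, p, sub_eq_zero]
  -- The image of `K8` already provides eight roots of a polynomial of degree eight.
  have hsub : Finset.univ.image ι ⊆ p.roots.toFinset := by
    intro y hy
    obtain ⟨a, -, rfl⟩ := Finset.mem_image.1 hy
    rw [hroot, ← map_pow, K8.pow_eight]
  have hcard : p.roots.toFinset.card ≤ (Finset.univ.image ι).card := by
    rw [Finset.card_image_of_injective _ ι.injective, Finset.card_univ, K8.card_eq, ← hdeg]
    exact (Multiset.toFinset_card_le _).trans p.card_roots'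
  have := (hroot x).2 hx
  rw [← Finset.eq_of_subset_of_card_le hsub hcard] at this
  obtain ⟨a, -, h⟩ := Finset.mem_image.1 this
  exact ⟨a, h⟩

/-- Frobenius generates a group of prime order three, so each nontrivial power generates it too. -/
theorem frob_pow_mul_eq : ∀ j k : Fin 3, j ≠ 0 → ∃ m : Fin 3, ∀ a,
    ((frob ^ (j : ℕ))^[(m : ℕ)]) a = (frob ^ (k : ℕ)) a := by
  decide +kernel

/-- An automorphism of `F` which acts nontrivially on the subfield with eight elements has powers
which induce all automorphisms of this subfield. -/
theorem exists_extension {F : Type*} [Field F] (ι : K8 →+* F) (σ : F ≃+* F) {x : F}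
    (hx : x ^ 8 = x) (hσ : σ x ≠ x) (s : K8 →+* K8) :
    ∃ τ : F ≃+* F, (τ : F →+* F).comp ι = ι.comp s := by
  obtain ⟨a, rfl⟩ := exists_eq_of_pow_eight ι hx
  obtain ⟨j, hj⟩ := exists_frob_pow ι ((σ : F →+* F).comp ι)
  obtain ⟨k, hk⟩ := exists_frob_pow (RingHom.id K8) s
  have hj0 : j ≠ 0 := by
    rintro rfl
    exact hσ (hj a)
  obtain ⟨m, hm⟩ := frob_pow_mul_eq j k hj0
  refine ⟨σ ^ (m : ℕ), ?_⟩
  ext b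
  have hpow (n : ℕ) (b : K8) : (σ ^ n) (ι b) = ι ((frob ^ (j : ℕ))^[n] b) := by
    induction n with
    | zero => rfl
    | succ n ih =>
      rw [pow_succ', Function.iterate_succ_apply']
      exact (congrArg σ ih).trans (hj _)
  change (σ ^ (m : ℕ)) (ι b) = ι (s b)
  rw [hpow, hm, hk]
  rfl

end K8

open UnitalPoint PGEmbedding in
theorem theorem1 (F : Type*) [Field F] (φ : ReeUnitalEmbedding F) :
    -- `F` has a subfield with eight elements
    (∃ K : Subfield F, Nat.card K = 8) ∧
    -- the image lies in a subplane of order 8, and the embedding in this subplane is admissible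
    (∃ S : Subplane (PGPoint F) (PGLine F), S.order = 8 ∧
      ∃ h : φ.ImageIn S, (φ.codRestrict S h).IsAdmissible) ∧
    -- uniqueness up to automorphisms of the unital and projective linear transformations
    (∀ ψ : ReeUnitalEmbedding F,
      ∃ (α : IncidenceAut ReeUnitalPoint ReeUnitalBlock)
        (β : IncidenceAut (PGPoint F) (PGLine F)), IsProjectiveLinear β ∧
          (∀ P : ReeUnitalPoint, ψ.point P = β.point (φ.point (α.point P))) ∧
          (∀ B : ReeUnitalBlock, ψ.line B = β.line (φ.line (α.line B)))) ∧
    -- admissibility in the whole plane, if `F` has an automorphism which does not fix the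
    -- subfield with eight elements pointwise
    ((∃ (σ : F ≃+* F) (x : F), x ^ 8 = x ∧ σ x ≠ x) → φ.IsAdmissible) := by
  obtain ⟨e, he⟩ := exists_isCoordinatization
  obtain ⟨ι, A, hA, hφ⟩ := he.exists_ofMatrix φ
  have hιmap {M : Matrix (Fin 3) (Fin 3) K8} (hM : M.det ≠ 0) : (M.map ι).det ≠ 0 := by
    rw [← RingHom.mapMatrix_apply, ← RingHom.map_det]
    exact (map_ne_zero ι).2 hM
  have hinv {M : Matrix (Fin 3) (Fin 3) F} (hM : M.det ≠ 0) : (M⁻¹).det ≠ 0 := by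
    rw [Matrix.det_nonsing_inv, Ring.inverse_eq_inv']
    exact inv_ne_zero hM
  have hmul {M N : Matrix (Fin 3) (Fin 3) F} (hM : M.det ≠ 0) (hN : N.det ≠ 0) :
      (M * N).det ≠ 0 := by
    rw [Matrix.det_mul]
    exact mul_ne_zero hM hN
  refine ⟨⟨ι.fieldRange, ?_⟩, ?_, fun ψ => ?_, ?_⟩
  · refine (Nat.card_congr (Equiv.ofInjective ι ι.injective)).symm.trans ?_
    rw [Nat.card_eq_fintype_card, K8.card_eq]
  · let E := ofMatrix ι A hA
    have hmem (P) : φ.point P ∈ E.rangeSubplane.points := ⟨std (e P), (hφ P).symm⟩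
    have hline (B) : φ.line B ∈ E.rangeSubplane.lines := by
      obtain ⟨u, hu, hB⟩ := he.exists_mem_iff B
      have hu0 : u ≠ 0 := by
        rintro rfl
        exact hu.1.elim (fun h => h rfl) (fun h => h rfl)
      refine ⟨Projectivization.mk K8 u hu0, (he.line_eq φ B _ fun P hP => ?_).symm⟩
      rw [hφ, IncidenceEmbedding.mem_iff]
      exact (dotProduct_comm _ _).trans ((hB P).1 hP)
    refine ⟨E.rangeSubplane, ?_, ⟨hmem, hline⟩, fun α => ?_⟩
    · have hcard := E.card_rangeSubplane
      have h73 : Nat.card (PGPoint K8) = 73 := by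
        rw [Projectivization.card_of_finrank K8 (Fin 3 → K8) (n := 3) (by simp),
          Nat.card_eq_fintype_card, K8.card_eq]
        rfl
      rw [h73] at hcard
      -- The order n satisfies n² + n + 1 = 73.
      nlinarith
    · obtain ⟨s, C, hC, h⟩ := he.exists_collineation α
      have hs : Function.Surjective s := Finite.surjective_of_injective s.injective
      refine ⟨(autOfMatrix hs C hC).onRange E, fun P => Subtype.ext ?_⟩
      change φ.point (α.point P) = ((autOfMatrix hs C hC).onRange E).point ⟨φ.point P, hmem P⟩
      rw [IncidenceAut.onRange_apply E _ (hφ P), hφ, h]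
      rfl
  · obtain ⟨κ, D, hD, hψ⟩ := he.exists_ofMatrix ψ
    -- The Frobenius power by which κ and ι differ is absorbed into an automorphism of the unital;
    -- what remains is the linear map D A⁻¹.
    obtain ⟨k, hk⟩ := K8.exists_frob_pow ι κ
    obtain ⟨α, hα⟩ := he.exists_aut (K8.frob ^ (k : ℕ))
    have hpt (P : ReeUnitalPoint) : ψ.point P =
        (autOfMatrix (σ := RingHom.id F) Function.surjective_id (D * A⁻¹)
          (hmul hD (hinv hA))).point (φ.point (α.point P)) := by
      rw [hφ, hα, hψ, autOfMatrix_point]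
      refine Eq.trans ?_ (ofMatrix_ofMatrix (κ := ι) (D := D) (hD := hD) rfl ?_ _).symm
      · change Projectivization.mk F _ _ = Projectivization.mk F _ _
        congr 1
        change D.mulVec (κ ∘ (e P).coord) = D.mulVec (ι ∘ (mapEquiv _ (e P)).coord)
        rw [coord_mapEquiv]
        congr 1
        exact funext fun i => hk _
      · change D = D * A⁻¹ * A
        rw [mul_assoc, Matrix.nonsing_inv_mul _ (isUnit_iff_ne_zero.2 hA), mul_one]
    refine ⟨α, _, isProjectiveLinear_autOfMatrix (D * A⁻¹) (hmul hD (hinv hA)), hpt, fun B => ?_⟩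
    refine he.line_eq ψ B _ fun P hP => ?_
    rw [hpt, IncidenceAut.mem_iff, IncidenceEmbedding.mem_iff, IncidenceAut.mem_iff]
    exact hP
  · rintro ⟨σ, x, hx, hσ⟩ α
    obtain ⟨s, C, hC, h⟩ := he.exists_collineation α
    obtain ⟨τ, hτ⟩ := K8.exists_extension ι σ hx hσ s
    have hAτ : (A.map (τ : F →+* F)).det ≠ 0 := by
      rw [← RingHom.mapMatrix_apply, ← RingHom.map_det]
      exact (map_ne_zero (τ : F →+* F)).2 hA
    -- The collineation v ↦ B τ(v) must satisfy B τ(A) = A ι(C), so that it induces the semilinear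
    -- map given by s and C on the subplane.
    have hB := hmul (hmul hA (hιmap hC)) (hinv hAτ)
    refine ⟨autOfMatrix (σ := (τ : F →+* F)) τ.surjective _ hB, fun P => ?_⟩
    rw [hφ, hφ, h, ofMatrix_ofMatrix (hD := hmul hA (hιmap hC)) rfl rfl]
    refine (ofMatrix_ofMatrix (hA := hB) (hC := hA) hτ.symm ?_ _).symm
    rw [mul_assoc, Matrix.nonsing_inv_mul _ (isUnit_iff_ne_zero.2 hAτ), mul_one]
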